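/- Let $K$ be a field of characteristic $0$, let $q\in K$ be non-zero and not a root of unity, $\lambda=q-q^{-1}$, and $N\ge 0$. Let $R_{12}$ be the Drinfeld–Jimbo $R$-matrix of $GL_q(N)$, $$R^{i_1i_2}_{j_1j_2}=\delta^{i_1}_{j_1}\delta^{i_2}_{j_2}\bigl(1+(q-1)\delta^{i_1i_2}\bigr)+\lambda\,\delta^{i_1}_{j_2}\delta^{i_2}_{j_1}\Theta_{i_1i_2},\qquad \Theta_{ij}=1\ (i>j),\ \Theta_{ij}=0\ (i\le j),$$ $\hat R=P_{12}R_{12}$ with $P_{12}$ the permutation matrix, $X_1=X\otimes 1$, $X_2=1\otimes X$ for an $N\times N$ matrix $X$, and $Tr_q(Y)=Tr(D^{-1}Y)$ with $(D^{-1})^i_j=q^{2(N-i)+1}\delta^i_j$ $(1\le i,j\le N)$. Let $\mathcal D$ be the unital associative $K$-algebra generated by the entries of $N\times N$ matrices $T,T^{-1}$ (functions on $GL_q(N)$), $L^{\pm},S(L^\pm)$ (the quantum algebra $U_q(gl(N))$), $\omega$ and $J$ with the relations $TT^{-1}=T^{-1}T=1$, $L^\pm S(L^\pm)=S(L^\pm)L^\pm=1$,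 $L^+$ upper and $L^-$ lower triangular with $(L^+)^i_i(L^-)^i_i=1$ for each $i$, $$\hat RL^\pm_2L^\pm_1=L^\pm_2L^\pm_1\hat R,\quad \hat RL^+_2L^-_1=L^-_2L^+_1\hat R,\quad \hat RT_1T_2=T_1T_2\hat R,$$ and, with $L=L^+S(L^-)$, $$\omega_2\hat R^{-1}\omega_2\hat R=-\hat R^{-1}\omega_2\hat R^{-1}\omega_2,\quad \omega_2\hat RL_2\hat R=\hat RL_2\hat R\omega_2,\quad \omega_2\hat RJ_2\hat R+\hat RJ_2\hat R\omega_2=-\hat R,$$ $$L_2\hat RL_2\hat R=\hat RL_2\hat RL_2,\quad J_2\hat RL_2\hat R=\hat RL_2\hat RJ_2,\quad J_2\hat RJ_2\hat R=-\hat R^{-1}J_2\hat RJ_2,$$ $$\omega_1T_2=T_2\hat R^{-1}\omega_2\hat R^{-1},\quad J_1T_2=T_2\hat RJ_2\hat R,\quad L_1T_2=T_2\hat RL_2\hat R.$$ Then: 1. Every product of $N^2+1$ entries of $\omega$ is zero in $\mathcal D$. The matrix $1+\lambda\omega J$ is invertible over $\mathcal D$, and its inverse is a finite sum $\sum_k c_k(\omega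 J)^k$ with $c_k\in K$. Hence $$Q=-\lambda^{-1}Tr_q(\omega)+\lambda^{-1}Tr_q\bigl(\omega L(1+\lambda\omega J)^{-1}\bigr)\in\mathcal D$$ is well defined by a finite series. Moreover $Q$ is a finite sum of ordered monomials: it lies in $\sum_{r=0}^{N^2-1}\Gamma^{r+1}\,(K+\Lambda)\,\Gamma_*^{\,r}$, where $\Gamma,\Lambda,\Gamma_*$ are the linear spans of the entries of $\omega,L,J$. For every $m\ge 0$, $$Q=Tr_q\Bigl(\omega\tfrac{L-1}{\lambda}-\sum_{k=0}^{m-1}(-\lambda)^k\,\omega L(\omega J)^{k+1}-(-\lambda)^m\,\omega L(\omega J)^{m+1}(1+\lambda\omega J)^{-1}\Bigr);$$ in particular, for $m=0$, $Q=Tr_q\bigl(\omega\frac{L-1}{\lambda}-\omega L(\omega J)(1+\lambda\omega J)^{-1}\bigr)$. 2. Entrywise, $Q^2=0$, $[Q,L]=0$, $[Q,T]=T\omega$, $[Q,\omega]_+=-\omega^2$, and $[Q,J]_+=\lambda^{-1}(1-L)$ (the Cartan identity). 3. Let $\Omega\subset\mathcal D$ be the subalgebra generated by the entries of $T,T^{-1},\omega$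 (the de Rham algebra of $GL_q(N)$), let $F$ be the subalgebra generated by the entries of $T,T^{-1}$, and let $\Omega^n$ be the span of the products $a_0\,\omega^{i_1}_{j_1}\,a_1\cdots\omega^{i_n}_{j_n}\,a_n$ with $a_k\in F$. There is exactly one $K$-linear map $d:\Omega\to\Omega$ with $d(xy)=d(x)y+(-1)^n x\,d(y)$ for all $x\in\Omega^n$, $y\in\Omega$, $n\ge 0$, and with $dT=T\omega$, $d\omega=-\omega^2$. It satisfies $d^2=0$, $d(\Omega^n)\subset\Omega^{n+1}$ and $d(x)=Qx-(-1)^n xQ$ for $x\in\Omega^n$. -/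

import Mathlib

open scoped Kronecker

namespace GLq

/-- The deformation constant `λ = q - q⁻¹`. -/
def lam {K : Type*} [Field K] (q : K) : K := q - q⁻¹

/-- The Drinfeld-Jimbo `R`-matrix of `GL_q(N)`: the entry in row `(i₁, i₂)` and column `(j₁, j₂)` is
`δ^{i₁}_{j₁} δ^{i₂}_{j₂} (1 + (q - 1) δ^{i₁ i₂}) + (q - q⁻¹) δ^{i₁}_{j₂} δ^{i₂}_{j₁} Θ_{i₁ i₂}`,
where `Θ_{i j} = 1` for `i > j` and `0` otherwise. -/
def rMat {K : Type*} [Field K] (N : ℕ) (q : K) : Matrix (Fin N × Fin N) (Fin N × Fin N) K :=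
  Matrix.of fun i j =>
    (if i.1 = j.1 ∧ i.2 = j.2 then 1 + (q - 1) * (if i.1 = i.2 then 1 else 0) else 0) +
      lam q * (if i.1 = j.2 ∧ i.2 = j.1 ∧ i.2 < i.1 then 1 else 0)

/-- The permutation matrix `P₁₂`. -/
def permMat (K : Type*) [Field K] (N : ℕ) : Matrix (Fin N × Fin N) (Fin N × Fin N) K :=
  Matrix.of fun i j => if i.1 = j.2 ∧ i.2 = j.1 then 1 else 0

/-- `R̂ = P₁₂ R₁₂`. -/
def rHat {K : Type*} [Field K] (N : ℕ) (q : K) : Matrix (Fin N × Fin N) (Fin N × Fin N) K :=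
  permMat K N * rMat N q

section TensorNotation

variable {K : Type*} [Field K] {A : Type*} [Ring A] [Algebra K A] {N : ℕ}

/-- `X₁ = X ⊗ 1`. -/
def leg1 (X : Matrix (Fin N) (Fin N) A) : Matrix (Fin N × Fin N) (Fin N × Fin N) A :=
  X ⊗ₖ (1 : Matrix (Fin N) (Fin N) A)

/-- `X₂ = 1 ⊗ X`. -/
def leg2 (X : Matrix (Fin N) (Fin N) A) : Matrix (Fin N × Fin N) (Fin N × Fin N) A :=
  (1 : Matrix (Fin N) (Fin N) A) ⊗ₖ X

variable (A N) in
/-- `R̂`, as a matrix with entries in a `K`-algebra `A`. -/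
def rH (q : K) : Matrix (Fin N × Fin N) (Fin N × Fin N) A :=
  (rHat N q).map (algebraMap K A)

variable (A N) in
/-- `R̂⁻¹`, as a matrix with entries in a `K`-algebra `A`. -/
noncomputable def rHinv (q : K) : Matrix (Fin N × Fin N) (Fin N × Fin N) A :=
  ((rHat N q)⁻¹).map (algebraMap K A)

/-- The quantum trace `Tr_q(Y) = Tr(D⁻¹ Y)`, where `D⁻¹` is diagonal with entries
`q^{2(N - i) + 1}`, `i = 1, …, N` (here `i` is counted from `0`). -/
def qTrace (q : K) (Y : Matrix (Fin N) (Fin N) A) : A :=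
  Matrix.trace ((Matrix.diagonal fun i : Fin N =>
    algebraMap K A (q ^ (2 * (N - 1 - (i : ℕ)) + 1))) * Y)

end TensorNotation

/-- The generators: the entries of `T` and `T⁻¹` (the quantum group `GL_q(N)`), of `L⁺`, `L⁻` and
their antipodes (the quantum algebra `U_q(gl(N))`), of `ω` (one-forms) and `J` (inner derivations).
-/
inductive Gen (N : ℕ) : Type
  | T (i j : Fin N)
  | Tinv (i j : Fin N)
  | Lp (i j : Fin N)
  | Lm (i j : Fin N)
  | SLp (i j : Fin N)
  | SLm (i j : Fin N)
  | om (i j : Fin N)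
  | J (i j : Fin N)

section Relations

variable (K : Type*) [Field K] (N : ℕ)

/-- The matrix of generators `c i j` in the free algebra. -/
def genMat (c : Fin N → Fin N → Gen N) : Matrix (Fin N) (Fin N) (FreeAlgebra K (Gen N)) :=
  Matrix.of fun i j => FreeAlgebra.ι K (c i j)

/-- `L = L⁺ S(L⁻)`, in the free algebra. -/
def freeL : Matrix (Fin N) (Fin N) (FreeAlgebra K (Gen N)) :=
  genMat K N Gen.Lp * genMat K N Gen.SLm

variable {K}

/-- `R̂`, as a matrix with entries in the free algebra. -/
abbrev freeR (q : K) : Matrix (Fin N × Fin N) (Fin N × Fin N) (FreeAlgebra K (Gen N)) :=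
  rH (FreeAlgebra K (Gen N)) N q

/-- `R̂⁻¹`, as a matrix with entries in the free algebra. -/
noncomputable abbrev freeRinv (q : K) :
    Matrix (Fin N × Fin N) (Fin N × Fin N) (FreeAlgebra K (Gen N)) :=
  rHinv (FreeAlgebra K (Gen N)) N q

end Relations

/-- The defining relations, entry by entry. -/
inductive Rel {K : Type*} [Field K] (N : ℕ) (q : K) :
    FreeAlgebra K (Gen N) → FreeAlgebra K (Gen N) → Prop
  -- the quantum group `Fun(GL_q(N))`
  | T_Tinv (i j : Fin N) : Rel N q
      ((genMat K N Gen.T * genMat K N Gen.Tinv) i j)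
      ((1 : Matrix (Fin N) (Fin N) (FreeAlgebra K (Gen N))) i j)
  | Tinv_T (i j : Fin N) : Rel N q
      ((genMat K N Gen.Tinv * genMat K N Gen.T) i j)
      ((1 : Matrix (Fin N) (Fin N) (FreeAlgebra K (Gen N))) i j)
  | T_T (i j : Fin N × Fin N) : Rel N q
      ((freeR N q * leg1 (genMat K N Gen.T) * leg2 (genMat K N Gen.T)) i j)
      ((leg1 (genMat K N Gen.T) * leg2 (genMat K N Gen.T) * freeR N q) i j)
  -- the quantum algebra `U_q(gl(N))`
  | Lp_SLp (i j : Fin N) : Rel N q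
      ((genMat K N Gen.Lp * genMat K N Gen.SLp) i j)
      ((1 : Matrix (Fin N) (Fin N) (FreeAlgebra K (Gen N))) i j)
  | SLp_Lp (i j : Fin N) : Rel N q
      ((genMat K N Gen.SLp * genMat K N Gen.Lp) i j)
      ((1 : Matrix (Fin N) (Fin N) (FreeAlgebra K (Gen N))) i j)
  | Lm_SLm (i j : Fin N) : Rel N q
      ((genMat K N Gen.Lm * genMat K N Gen.SLm) i j)
      ((1 : Matrix (Fin N) (Fin N) (FreeAlgebra K (Gen N))) i j)
  | SLm_Lm (i j : Fin N) : Rel N q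
      ((genMat K N Gen.SLm * genMat K N Gen.Lm) i j)
      ((1 : Matrix (Fin N) (Fin N) (FreeAlgebra K (Gen N))) i j)
  | Lp_upper (i j : Fin N) (h : j < i) : Rel N q (genMat K N Gen.Lp i j) 0
  | Lm_lower (i j : Fin N) (h : i < j) : Rel N q (genMat K N Gen.Lm i j) 0
  | L_diag (i : Fin N) : Rel N q (genMat K N Gen.Lp i i * genMat K N Gen.Lm i i) 1
  | Lp_Lp (i j : Fin N × Fin N) : Rel N q
      ((freeR N q * leg2 (genMat K N Gen.Lp) * leg1 (genMat K N Gen.Lp)) i j)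
      ((leg2 (genMat K N Gen.Lp) * leg1 (genMat K N Gen.Lp) * freeR N q) i j)
  | Lm_Lm (i j : Fin N × Fin N) : Rel N q
      ((freeR N q * leg2 (genMat K N Gen.Lm) * leg1 (genMat K N Gen.Lm)) i j)
      ((leg2 (genMat K N Gen.Lm) * leg1 (genMat K N Gen.Lm) * freeR N q) i j)
  | Lp_Lm (i j : Fin N × Fin N) : Rel N q
      ((freeR N q * leg2 (genMat K N Gen.Lp) * leg1 (genMat K N Gen.Lm)) i j)
      ((leg2 (genMat K N Gen.Lm) * leg1 (genMat K N Gen.Lp) * freeR N q) i j)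
  -- the commutation relations of `ω`, `L`, `J`
  | om_om (i j : Fin N × Fin N) : Rel N q
      ((leg2 (genMat K N Gen.om) * freeRinv N q * leg2 (genMat K N Gen.om) * freeR N q) i j)
      ((-(freeRinv N q * leg2 (genMat K N Gen.om) * freeRinv N q * leg2 (genMat K N Gen.om))) i j)
  | om_L (i j : Fin N × Fin N) : Rel N q
      ((leg2 (genMat K N Gen.om) * freeR N q * leg2 (freeL K N) * freeR N q) i j)
      ((freeR N q * leg2 (freeL K N) * freeR N q * leg2 (genMat K N Gen.om)) i j)
  | om_J (i j : Fin N × Fin N) : Rel N q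
      ((leg2 (genMat K N Gen.om) * freeR N q * leg2 (genMat K N Gen.J) * freeR N q +
        freeR N q * leg2 (genMat K N Gen.J) * freeR N q * leg2 (genMat K N Gen.om)) i j)
      ((-(freeR N q)) i j)
  | L_L (i j : Fin N × Fin N) : Rel N q
      ((leg2 (freeL K N) * freeR N q * leg2 (freeL K N) * freeR N q) i j)
      ((freeR N q * leg2 (freeL K N) * freeR N q * leg2 (freeL K N)) i j)
  | J_L (i j : Fin N × Fin N) : Rel N q
      ((leg2 (genMat K N Gen.J) * freeR N q * leg2 (freeL K N) * freeR N q) i j)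
      ((freeR N q * leg2 (freeL K N) * freeR N q * leg2 (genMat K N Gen.J)) i j)
  | J_J (i j : Fin N × Fin N) : Rel N q
      ((leg2 (genMat K N Gen.J) * freeR N q * leg2 (genMat K N Gen.J) * freeR N q) i j)
      ((-(freeRinv N q * leg2 (genMat K N Gen.J) * freeR N q * leg2 (genMat K N Gen.J))) i j)
  -- the commutation relations with `T`
  | om_T (i j : Fin N × Fin N) : Rel N q
      ((leg1 (genMat K N Gen.om) * leg2 (genMat K N Gen.T)) i j)
      ((leg2 (genMat K N Gen.T) * freeRinv N q * leg2 (genMat K N Gen.om) * freeRinv N q) i j)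
  | J_T (i j : Fin N × Fin N) : Rel N q
      ((leg1 (genMat K N Gen.J) * leg2 (genMat K N Gen.T)) i j)
      ((leg2 (genMat K N Gen.T) * freeR N q * leg2 (genMat K N Gen.J) * freeR N q) i j)
  | L_T (i j : Fin N × Fin N) : Rel N q
      ((leg1 (freeL K N) * leg2 (genMat K N Gen.T)) i j)
      ((leg2 (genMat K N Gen.T) * freeR N q * leg2 (freeL K N) * freeR N q) i j)

/-- The differential algebra over `GL_q(N)`. -/
abbrev DiffAlg {K : Type*} [Field K] (N : ℕ) (q : K) : Type _ := RingQuot (Rel N q)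

section Elements

variable {K : Type*} [Field K] (N : ℕ) (q : K)

/-- The matrix of generators `c i j` in the differential algebra. -/
noncomputable def matOf (c : Fin N → Fin N → Gen N) : Matrix (Fin N) (Fin N) (DiffAlg N q) :=
  (genMat K N c).map (RingQuot.mkAlgHom K (Rel N q))

/-- The matrix `T`. -/
noncomputable def matT : Matrix (Fin N) (Fin N) (DiffAlg N q) := matOf N q Gen.T

/-- The matrix `T⁻¹`. -/
noncomputable def matTinv : Matrix (Fin N) (Fin N) (DiffAlg N q) := matOf N q Gen.Tinv

/-- The matrix `L = L⁺ S(L⁻)`. -/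
noncomputable def matL : Matrix (Fin N) (Fin N) (DiffAlg N q) :=
  matOf N q Gen.Lp * matOf N q Gen.SLm

/-- The matrix `ω`. -/
noncomputable def matOm : Matrix (Fin N) (Fin N) (DiffAlg N q) := matOf N q Gen.om

/-- The matrix `J`. -/
noncomputable def matJ : Matrix (Fin N) (Fin N) (DiffAlg N q) := matOf N q Gen.J

/-- The matrix `W = 1 + λ ω J`. -/
noncomputable def matW : Matrix (Fin N) (Fin N) (DiffAlg N q) :=
  1 + lam q • (matOm N q * matJ N q)

/-- The matrix `(1 + λ ω J)⁻¹`: the two-sided inverse in the ring of `N × N` matrices over the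
differential algebra (the junk value `0` of `Ring.inverse` is excluded by the theorem). -/
noncomputable def matWinv : Matrix (Fin N) (Fin N) (DiffAlg N q) := Ring.inverse (matW N q)

/-- The BRST operator `Q = -λ⁻¹ Tr_q(ω) + λ⁻¹ Tr_q(ω L (1 + λ ω J)⁻¹)`. -/
noncomputable def brst : DiffAlg N q :=
  -((lam q)⁻¹ • qTrace q (matOm N q)) +
    (lam q)⁻¹ • qTrace q (matOm N q * matL N q * matWinv N q)

/-- The linear span of the entries of a matrix. -/
def entrySpan (X : Matrix (Fin N) (Fin N) (DiffAlg N q)) : Submodule K (DiffAlg N q) :=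
  Submodule.span K {x | ∃ i j, x = X i j}

/-- The algebra of functions on `GL_q(N)`: the subalgebra generated by the entries of `T`, `T⁻¹`. -/
noncomputable def funAlg : Subalgebra K (DiffAlg N q) :=
  Algebra.adjoin K {x | ∃ i j, x = matT N q i j ∨ x = matTinv N q i j}

/-- The de Rham algebra of `GL_q(N)`: the subalgebra generated by the entries of `T`, `T⁻¹`, `ω`. -/
noncomputable def deRham : Subalgebra K (DiffAlg N q) :=
  Algebra.adjoin K {x | ∃ i j, x = matT N q i j ∨ x = matTinv N q i j ∨ x = matOm N q i j}

/-- The `n`-forms: the span of the products `a₀ ω a₁ ω a₂ ⋯ ω aₙ` of `n` entries of `ω` and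
functions `aₖ` on `GL_q(N)`. -/
noncomputable def forms (n : ℕ) : Submodule K (DiffAlg N q) :=
  Subalgebra.toSubmodule (funAlg N q) *
    (entrySpan N q (matOm N q) * Subalgebra.toSubmodule (funAlg N q)) ^ n

/-- `d` is a de Rham differential: a graded derivation of the de Rham algebra with `dT = T ω` and
`dω = -ω²`. -/
structure IsDeRhamDifferential (d : deRham N q →ₗ[K] deRham N q) : Prop where
  leibniz : ∀ (n : ℕ) (x y : deRham N q), (x : DiffAlg N q) ∈ forms N q n →
    d (x * y) = d x * y + (-1) ^ n * (x * d y)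
  map_T : ∀ (i j : Fin N) (x : deRham N q), (x : DiffAlg N q) = matT N q i j →
    (d x : DiffAlg N q) = (matT N q * matOm N q) i j
  map_om : ∀ (i j : Fin N) (x : deRham N q), (x : DiffAlg N q) = matOm N q i j →
    (d x : DiffAlg N q) = -(matOm N q * matOm N q) i j

end Elements

end GLq

/-! Put `W = 1 + λωJ`, `V = W⁻¹` and `Θ = ωLV`, so that `λQ = Tr_q Θ - Tr_q ω`. The commutation
rules of `Q` rest on two facts about `R̂`: the Hecke condition `R̂ - R̂⁻¹ = λ` (`rH_mul_rH`), and
the behaviour of the quantum trace over the first factor, which sends `R̂⁻¹` to `1` and `R̂^{∓1} X₂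
R̂^{±1}` to the scalar matrix `Tr_q X` (`qTrace1_rHinv`, `qTrace1_rHinv_leg2_rH`,
`qTrace1_rH_leg2_rHinv`). The Yang–Baxter equation is not needed.

The form of `W` is chosen so that the Hecke term `λ` absorbs the inhomogeneous part of the `ω`-`J`
relation; `W` then passes through `ω` and `J` homogeneously (`braid_W_om`, `braid_J_W`). Hence `V`
does too, and `Θ` obeys the same reflection relation as `ω` (`reflectionOdd_theta`). Tracing the
matrix relations shows that `Tr_q Θ` commutes with `T` and `L`, anticommutes with `ω` and has
anticommutator `-L` with `J`, while `Tr_q ω` commutes with `L` and contributes `-λTω`, `λω²` and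
`-1` against `T`, `ω` and `J`. The difference gives every rule for `Q`. Moreover `Q² = 0`, because
the two traces anticommute and each squares to zero (`ReflectionOdd.sq_qTrace`).

Finiteness comes from the entries of `Tω`, which obey `q`-exterior relations in `N²` generators, so
that long products vanish (`pow_entries_exterior`). This passes to `ω = T⁻¹(Tω)` after moving `T⁻¹`
to the left. As `Jω` contracts to scalars, this does not by itself make `ωJ` nilpotent. Instead a
right inverse of `W` is built modulo increasing powers of `ω` (`exists_right_inverse_mod`), and
finite-dimensionality of `K[ωJ]` puts the inverse in that algebra (`exists_inverse`).

The differential is the graded commutator with `Q`, its sign given by the parity automorphism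
negating `ω` and `J`. Its degree is checked on generators, and uniqueness holds because a graded
derivation killing the generators is zero (`gradedDerivation_eq_zero`). -/

namespace GLq

/-! ### The Hecke matrix and the quantum trace over one tensor factor -/

section RMatrix

variable {K : Type*} [Field K] {A : Type*} [Ring A] [Algebra K A] {N : ℕ}

/-- The permutation turns the diagonal part of `R` into a weighted flip and its triangular part into
a diagonal term. Multiplying by `R̂` therefore combines only two entries, and the identities below
become case distinctions on the order of indices. -/
theorem rHat_apply (q : K) (i j : Fin N × Fin N) :
    rHat N q i j = (if i.2 = j.1 ∧ i.1 = j.2 then (if i.1 = i.2 then q else 1) else 0) +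
      (if i = j then (if i.1 < i.2 then lam q else 0) else 0) := by
  obtain ⟨i1, i2⟩ := i
  obtain ⟨j1, j2⟩ := j
  rw [rHat, Matrix.mul_apply, Finset.sum_eq_single (i2, i1)]
  · simp only [permMat, rMat, Matrix.of_apply, Prod.mk.injEq, and_self, if_true, one_mul]
    congr 1
    · by_cases h : i1 = i2
      · simp [h]
      · simp [h, Ne.symm h]
    · by_cases h1 : i1 = j1 <;> by_cases h2 : i2 = j2 <;> simp [h1, h2]
  · rintro ⟨b1, b2⟩ - hb
    simp only [permMat, Matrix.of_apply]
    rw [if_neg, zero_mul]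
    rintro ⟨h1, h2⟩
    exact hb (by simp_all)
  · simp

theorem rH_mul_apply {m : Type*} (q : K) (Y : Matrix (Fin N × Fin N) m A) (i1 i2 : Fin N) (j : m) :
    (rH A N q * Y) (i1, i2) j = (if i1 = i2 then q else 1) • Y (i2, i1) j +
      (if i1 < i2 then lam q else 0) • Y (i1, i2) j := by
  rw [Matrix.mul_apply]
  simp only [rH, Matrix.map_apply, rHat_apply, ← Algebra.smul_def, add_smul, ite_smul, zero_smul,
    Finset.sum_add_distrib]
  congr 1
  · rw [Finset.sum_eq_single (i2, i1)]
    · simp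
    · rintro ⟨b1, b2⟩ - hb
      rw [if_neg]
      rintro ⟨h1, h2⟩
      exact hb (by simp_all)
    · simp
  · simp

theorem mul_rH_apply {m : Type*} (q : K) (Y : Matrix m (Fin N × Fin N) A) (i : m) (j1 j2 : Fin N) :
    (Y * rH A N q) i (j1, j2) = (if j1 = j2 then q else 1) • Y i (j2, j1) +
      (if j1 < j2 then lam q else 0) • Y i (j1, j2) := by
  rw [Matrix.mul_apply]
  simp only [rH, Matrix.map_apply, rHat_apply, ← Algebra.commutes, ← Algebra.smul_def, add_smul,
    ite_smul, zero_smul, Finset.sum_add_distrib]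
  congr 1
  · rw [Finset.sum_eq_single (j2, j1)]
    · by_cases h : j1 = j2 <;> simp [h, eq_comm]
    · rintro ⟨b1, b2⟩ - hb
      rw [if_neg]
      rintro ⟨h1, h2⟩
      exact hb (by simp_all)
    · simp
  · simp

/-- The Hecke condition. -/
theorem rH_mul_rH {q : K} (hq0 : q ≠ 0) :
    rH A N q * rH A N q = lam q • rH A N q + 1 := by
  -- A general `Y` lets `R̂` be applied twice through its action on rows; `Y = 1` recovers the
  -- identity.
  have key : ∀ Y : Matrix (Fin N × Fin N) (Fin N × Fin N) A,
      rH A N q * (rH A N q * Y) = lam q • (rH A N q * Y) + Y := by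
    intro Y
    ext ⟨i1, i2⟩ j
    rw [rH_mul_apply, Matrix.add_apply, Matrix.smul_apply]
    simp only [rH_mul_apply]
    have hqq : q * q = lam q * q + 1 := by
      simp only [lam]; field_simp; ring
    rcases lt_trichotomy i1 i2 with h | h | h
    · simp only [h, h.ne, h.ne', h.not_gt, if_true, if_false]
      module
    · subst h
      simp only [lt_irrefl, if_true, if_false, zero_smul, zero_mul, add_zero, smul_smul, hqq,
        add_smul, one_smul]
    · simp only [h, h.ne, h.ne', h.not_gt, if_true, if_false]
      module
  simpa using key 1

theorem rHinv_eq {q : K} (hq0 : q ≠ 0) : rHinv A N q = rH A N q - lam q • 1 := by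
  have h1 : rH K N q = rHat N q := by
    ext i j; simp [rH]
  have h : rHat N q * (rHat N q - lam q • 1) = 1 := by
    have := rH_mul_rH (A := K) (N := N) hq0
    rw [h1] at this
    rw [mul_sub, this]
    simp
  rw [rHinv, Matrix.inv_eq_right_inv h, rH]
  ext i j
  by_cases hij : i = j
  · simp [hij, Algebra.algebraMap_eq_smul_one, sub_smul]
  · simp [hij]

theorem rH_mul_rHinv {q : K} (hq0 : q ≠ 0) : rH A N q * rHinv A N q = 1 := by
  rw [rHinv_eq hq0, mul_sub, rH_mul_rH hq0]; simp

theorem rHinv_mul_rH {q : K} (hq0 : q ≠ 0) : rHinv A N q * rH A N q = 1 := by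
  rw [rHinv_eq hq0, sub_mul, rH_mul_rH hq0]; simp

/-- The diagonal entries of `D⁻¹`. -/
def qWeight (q : K) (i : Fin N) : K := q ^ (2 * (N - 1 - (i : ℕ)) + 1)

theorem qTrace_eq (q : K) (Y : Matrix (Fin N) (Fin N) A) :
    qTrace q Y = ∑ i, qWeight q i • Y i i := by
  simp [qTrace, Matrix.trace, qWeight, Algebra.smul_def, Matrix.diagonal_mul]

/-- The weights beyond `i` are `q, q³, …, q^{2(N-1-i)-1}`, and multiplication by `λ` telescopes
their sum. This is the property of `D⁻¹` on which the partial traces depend. -/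
theorem sum_qWeight {q : K} (hq0 : q ≠ 0) (i : Fin N) :
    lam q * ∑ k : Fin N, (if i < k then qWeight q k else 0) = q⁻¹ * qWeight q i - 1 := by
  have tele : ∀ n : ℕ, lam q * ∑ m ∈ Finset.range n, q ^ (2 * m + 1) = q ^ (2 * n) - 1 := by
    intro n
    induction n with
    | zero => simp
    | succ n ih =>
      rw [Finset.sum_range_succ, mul_add, ih, lam]
      field_simp
      ring
  have hsum : ∑ k : Fin N, (if i < k then qWeight q k else 0) =
      ∑ m ∈ Finset.range (N - 1 - i), q ^ (2 * m + 1) := by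
    rw [← Finset.sum_filter]
    refine Finset.sum_bij' (fun k _ => N - 1 - (k : ℕ))
      (fun m hm => ⟨N - 1 - m, by have := i.2; omega⟩) ?_ ?_ ?_ ?_ ?_
    · intro k hk
      simp only [Finset.mem_filter, Finset.mem_univ, true_and, Fin.lt_def] at hk
      simp only [Finset.mem_range]
      have := k.2
      omega
    · intro m hm
      simp only [Finset.mem_range] at hm
      simp only [Finset.mem_filter, Finset.mem_univ, true_and, Fin.lt_def]
      omega
    · intro k hk
      ext
      have := k.2
      simp only
      omega
    · intro m hm
      simp only [Finset.mem_range] at hm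
      simp only
      omega
    · intro k _
      rfl
  rw [hsum, tele, qWeight, pow_succ]
  field_simp

/-- The quantum trace over the first tensor factor. -/
def qTrace1 (q : K) (Y : Matrix (Fin N × Fin N) (Fin N × Fin N) A) : Matrix (Fin N) (Fin N) A :=
  Matrix.of fun i j => ∑ k, qWeight q k • Y (k, i) (k, j)

theorem qTrace1_add (q : K) (Y Z : Matrix (Fin N × Fin N) (Fin N × Fin N) A) :
    qTrace1 q (Y + Z) = qTrace1 q Y + qTrace1 q Z := by
  ext i j; simp [qTrace1, Finset.sum_add_distrib]

theorem qTrace1_smul (q c : K) (Y : Matrix (Fin N × Fin N) (Fin N × Fin N) A) :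
    qTrace1 q (c • Y) = c • qTrace1 q Y := by
  ext i j; simp [qTrace1, Finset.smul_sum, smul_smul, mul_comm]

theorem qTrace1_neg (q : K) (Y : Matrix (Fin N × Fin N) (Fin N × Fin N) A) :
    qTrace1 q (-Y) = -qTrace1 q Y := by
  ext i j; simp [qTrace1]

theorem qTrace1_sub (q : K) (Y Z : Matrix (Fin N × Fin N) (Fin N × Fin N) A) :
    qTrace1 q (Y - Z) = qTrace1 q Y - qTrace1 q Z := by
  ext i j; simp [qTrace1, smul_sub]

theorem leg2_mul_apply {m : Type*} (X : Matrix (Fin N) (Fin N) A) (Y : Matrix (Fin N × Fin N) m A)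
    (i1 i2 : Fin N) (j : m) : (leg2 X * Y) (i1, i2) j = ∑ k, X i2 k * Y (i1, k) j := by
  simp [leg2, Matrix.mul_apply, Fintype.sum_prod_type, Matrix.one_apply]

theorem mul_leg2_apply {m : Type*} (X : Matrix (Fin N) (Fin N) A) (Y : Matrix m (Fin N × Fin N) A)
    (i : m) (j1 j2 : Fin N) : (Y * leg2 X) i (j1, j2) = ∑ k, Y i (j1, k) * X k j2 := by
  rw [Matrix.mul_apply, Fintype.sum_prod_type, Finset.sum_eq_single j1]
  · simp [leg2]
  · intro b _ hb
    simp [leg2, hb]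
  · simp

theorem leg1_mul_apply {m : Type*} (X : Matrix (Fin N) (Fin N) A) (Y : Matrix (Fin N × Fin N) m A)
    (i1 i2 : Fin N) (j : m) : (leg1 X * Y) (i1, i2) j = ∑ k, X i1 k * Y (k, i2) j := by
  simp [leg1, Matrix.mul_apply, Fintype.sum_prod_type, Matrix.one_apply]

theorem leg2_mul (X Y : Matrix (Fin N) (Fin N) A) : leg2 (X * Y) = leg2 X * leg2 Y := by
  ext ⟨i1, i2⟩ ⟨j1, j2⟩
  rw [leg2_mul_apply]
  by_cases h : i1 = j1 <;> simp [leg2, Matrix.mul_apply, h]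

theorem leg1_mul (X Y : Matrix (Fin N) (Fin N) A) : leg1 (X * Y) = leg1 X * leg1 Y := by
  ext ⟨i1, i2⟩ ⟨j1, j2⟩
  rw [leg1_mul_apply]
  by_cases h : i2 = j2 <;> simp [leg1, Matrix.mul_apply, h]

theorem leg2_one : leg2 (1 : Matrix (Fin N) (Fin N) A) = 1 := by simp [leg2]

theorem leg1_one : leg1 (1 : Matrix (Fin N) (Fin N) A) = 1 := by simp [leg1]

theorem leg2_add (X Y : Matrix (Fin N) (Fin N) A) : leg2 (X + Y) = leg2 X + leg2 Y := by
  ext i j; simp [leg2, mul_add]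

theorem leg2_smul (c : K) (X : Matrix (Fin N) (Fin N) A) : leg2 (c • X) = c • leg2 X := by
  ext i j; simp [leg2]

theorem leg1_add (X Y : Matrix (Fin N) (Fin N) A) : leg1 (X + Y) = leg1 X + leg1 Y := by
  ext i j; simp [leg1, add_mul]

theorem leg1_smul (c : K) (X : Matrix (Fin N) (Fin N) A) : leg1 (c • X) = c • leg1 X := by
  ext i j; simp [leg1]

theorem leg2_neg (X : Matrix (Fin N) (Fin N) A) : leg2 (-X) = -leg2 X := by
  ext i j; simp [leg2]

theorem leg1_neg (X : Matrix (Fin N) (Fin N) A) : leg1 (-X) = -leg1 X := by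
  ext i j; simp [leg1]

theorem qTrace1_leg2_mul (q : K) (X : Matrix (Fin N) (Fin N) A)
    (Y : Matrix (Fin N × Fin N) (Fin N × Fin N) A) :
    qTrace1 q (leg2 X * Y) = X * qTrace1 q Y := by
  ext i j
  simp only [qTrace1, Matrix.of_apply, leg2_mul_apply]
  simp only [Matrix.mul_apply, Matrix.of_apply, Finset.smul_sum, Finset.mul_sum, mul_smul_comm]
  exact Finset.sum_comm

theorem qTrace1_mul_leg2 (q : K) (X : Matrix (Fin N) (Fin N) A)
    (Y : Matrix (Fin N × Fin N) (Fin N × Fin N) A) :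
    qTrace1 q (Y * leg2 X) = qTrace1 q Y * X := by
  ext i j
  simp only [qTrace1, Matrix.of_apply, mul_leg2_apply]
  simp only [Matrix.mul_apply, Matrix.of_apply, Finset.smul_sum, Finset.sum_mul, smul_mul_assoc]
  exact Finset.sum_comm

theorem qTrace1_leg1 (q : K) (X : Matrix (Fin N) (Fin N) A) :
    qTrace1 q (leg1 X) = Matrix.diagonal fun _ => qTrace q X := by
  ext i j
  by_cases h : i = j <;> simp [qTrace1, leg1, qTrace_eq, h]

theorem rHinv_mul_apply {m : Type*} {q : K} (hq0 : q ≠ 0) (Y : Matrix (Fin N × Fin N) m A)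
    (i1 i2 : Fin N) (j : m) :
    (rHinv A N q * Y) (i1, i2) j = (if i1 = i2 then q⁻¹ else 1) • Y (i2, i1) j -
      (if i2 < i1 then lam q else 0) • Y (i1, i2) j := by
  rw [rHinv_eq hq0, Matrix.sub_mul, Matrix.sub_apply, rH_mul_apply, Matrix.smul_mul, Matrix.one_mul,
    Matrix.smul_apply]
  rcases lt_trichotomy i1 i2 with h | h | h
  · simp [h, h.ne, h.not_gt]
  · subst h
    simp [lam, sub_smul]
  · simp [h, h.ne', h.not_gt]

theorem mul_rHinv_apply {m : Type*} {q : K} (hq0 : q ≠ 0) (Y : Matrix m (Fin N × Fin N) A)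
    (i : m) (j1 j2 : Fin N) :
    (Y * rHinv A N q) i (j1, j2) = (if j1 = j2 then q⁻¹ else 1) • Y i (j2, j1) -
      (if j2 < j1 then lam q else 0) • Y i (j1, j2) := by
  rw [rHinv_eq hq0, Matrix.mul_sub, Matrix.sub_apply, mul_rH_apply, Matrix.mul_smul, Matrix.mul_one,
    Matrix.smul_apply]
  rcases lt_trichotomy j1 j2 with h | h | h
  · simp [h, h.ne, h.not_gt]
  · subst h
    simp [lam, sub_smul]
  · simp [h, h.ne', h.not_gt]

/-- On the diagonal the flip gives `q⁻¹` times one weight, and the triangular part subtracts `λ`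
times the weights beyond it; `sum_qWeight` leaves `1`. -/
theorem qTrace1_rHinv {q : K} (hq0 : q ≠ 0) : qTrace1 q (rHinv A N q) = 1 := by
  ext i j
  have hE : ∀ k, qWeight q k • rHinv A N q (k, i) (k, j) =
      if i = j then (algebraMap K A ((if k = i then q⁻¹ * qWeight q k else 0)
        - lam q * (if i < k then qWeight q k else 0))) else 0 := by
    intro k
    have := rHinv_mul_apply hq0 (1 : Matrix (Fin N × Fin N) (Fin N × Fin N) A) k i (k, j)
    rw [Matrix.mul_one] at this
    rw [this]
    simp only [Matrix.one_apply, Prod.mk.injEq, Algebra.smul_def]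
    by_cases h : i = j
    · subst h
      by_cases hk : k = i
      · subst hk
        simp [mul_comm]
      · by_cases hik : i < k <;>
          simp [hk, Ne.symm hk, hik, ← map_mul, mul_comm (lam q)]
    · have : ¬(i = k ∧ k = j) := fun h' => h (h'.1.trans h'.2)
      simp [h, this]
  simp only [qTrace1, Matrix.of_apply, hE]
  by_cases h : i = j
  · subst h
    simp only [if_true]
    rw [← map_sum, Finset.sum_sub_distrib, ← Finset.mul_sum, sum_qWeight hq0]
    simp
  · simp [h]

theorem qTrace1_rHinv_leg2_rH {q : K} (hq0 : q ≠ 0) (X : Matrix (Fin N) (Fin N) A) :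
    qTrace1 q (rHinv A N q * leg2 X * rH A N q) = Matrix.diagonal fun _ => qTrace q X := by
  ext i j
  have hE : ∀ k, qWeight q k • (rHinv A N q * leg2 X * rH A N q) (k, i) (k, j) =
      if i = j then qWeight q k • X k k else if i < j then
        (lam q * ((if k = i then q⁻¹ * qWeight q k else 0) - (if k = j then q * qWeight q k else 0)
        - lam q * ((if i < k then qWeight q k else 0) - (if j < k then qWeight q k else 0)
          - if k = j then qWeight q k else 0))) • X i j else 0 := by
    intro k
    rw [mul_rH_apply, rHinv_mul_apply hq0, rHinv_mul_apply hq0]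
    simp only [leg2, Matrix.kroneckerMap_apply, Matrix.one_apply]
    rcases lt_trichotomy i j with h | h | h <;> rcases lt_trichotomy k i with h1 | h1 | h1 <;>
      rcases lt_trichotomy k j with h2 | h2 | h2 <;>
      first
      | (exfalso; subst_vars; order)
      | (subst_vars
         simp [*, ne_of_lt, ne_of_gt, not_lt_of_gt, smul_smul]
         try module)
  simp only [qTrace1, Matrix.of_apply, hE]
  rcases lt_trichotomy i j with h | h | h
  -- For `i < j` the tails beyond `i` and `j` cancel the diagonal contributions, using `λ = q -
  -- q⁻¹`.
  · simp only [h.ne, h, if_true, if_false]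
    rw [← Finset.sum_smul, ← Finset.mul_sum]
    simp only [Finset.sum_sub_distrib, ← Finset.mul_sum, mul_sub, sum_qWeight hq0]
    simp [lam, Matrix.diagonal_apply_ne _ h.ne]
    left
    ring
  · subst h
    simp [qTrace_eq]
  · simp [h.ne', h.not_gt]

/-- Exchanging `R̂` and `R̂⁻¹` changes the conjugate by `λ(X₂R̂⁻¹ - R̂⁻¹X₂)`, and both terms have
partial trace `X`. -/
theorem qTrace1_rH_leg2_rHinv {q : K} (hq0 : q ≠ 0) (X : Matrix (Fin N) (Fin N) A) :
    qTrace1 q (rH A N q * leg2 X * rHinv A N q) = Matrix.diagonal fun _ => qTrace q X := by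
  rw [← qTrace1_rHinv_leg2_rH hq0]
  have e : rH A N q * leg2 X * rHinv A N q = rHinv A N q * leg2 X * rH A N q
      + lam q • (leg2 X * rHinv A N q) - lam q • (rHinv A N q * leg2 X) := by
    have hr : rH A N q = rHinv A N q + lam q • 1 := by rw [rHinv_eq hq0]; abel
    rw [hr]
    simp only [add_mul, mul_add, smul_mul_assoc, mul_smul_comm, one_mul, mul_one]
    abel
  rw [e, qTrace1_sub, qTrace1_add, qTrace1_smul, qTrace1_smul, qTrace1_leg2_mul, qTrace1_mul_leg2,
    qTrace1_rHinv hq0]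
  simp

/-- `R̂` commutes with `D⁻¹ ⊗ D⁻¹`, so it is cyclic under the quantum trace over both factors. -/
theorem qTrace_qTrace1_rH_comm (q : K) (Y : Matrix (Fin N × Fin N) (Fin N × Fin N) A) :
    qTrace q (qTrace1 q (rH A N q * Y)) = qTrace q (qTrace1 q (Y * rH A N q)) := by
  simp only [qTrace_eq, qTrace1, Matrix.of_apply, rH_mul_apply, mul_rH_apply, smul_add,
    Finset.sum_add_distrib, Finset.smul_sum]
  congr 1
  rw [Finset.sum_comm]
  refine Finset.sum_congr rfl fun i _ => Finset.sum_congr rfl fun k _ => ?_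
  by_cases h : i = k
  · subst h; rfl
  · rw [if_neg h, if_neg (Ne.symm h), smul_comm]

end RMatrix

/-! ### Exchange identities in an abstract algebra: `r`, `s` stand for `R̂`, `R̂⁻¹` and `o`, `l`,
`j`, `v` for `ω₂`, `L₂`, `J₂`, `V₂` -/

section BraidedIdentities

variable {K : Type*} [Field K] {M : Type*} [Ring M] [Algebra K M] {c : K} {r s o l j v : M}

theorem mul_tail {a b : M} (h : a * b = 1) (x : M) : a * (b * x) = x := by
  rw [← mul_assoc, h, one_mul]

/-- Multiplying the `ω`-`J` relation by `ωR̂⁻¹` on the left and reordering the two `ω` leaves an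
inhomogeneous term `-ω`. With coefficient `c` it cancels the difference `R̂ω - R̂⁻¹ω = cω`, so the
rule for `W` is homogeneous. -/
theorem braid_W_om (hsr : s * r = 1) (hc : r = s + c • 1)
    (hoo : o * s * o * r = -(s * o * s * o)) (hoj : o * r * j * r + r * j * r * o = -r) :
    (1 + c • (o * j)) * r * o = s * o * s * (1 + c • (o * j)) * r := by
  have h1 : o * j * r * o = s * o * s * o * j * r - o := by
    have h := congrArg (fun z => o * s * z) hoj
    have h' : ∀ x, o * (s * (o * (r * x))) = -(s * (o * (s * (o * x)))) := fun x => by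
      simpa only [mul_assoc, neg_mul] using congrArg (· * x) hoo
    simp only [mul_assoc, mul_add, mul_tail hsr, mul_neg, hsr, mul_one, h'] at h
    simp only [mul_assoc]
    rw [eq_sub_iff_add_eq, ← sub_eq_zero]
    rw [← sub_eq_zero] at h
    rw [← h]
    abel
  have h2 : r * o = s * o + c • o := by rw [hc]; simp [add_mul]
  have h3 : s * o * s * r = s * o := by rw [mul_assoc, hsr, mul_one]
  calc (1 + c • (o * j)) * r * o = r * o + c • (o * j * r * o) := by
        simp only [add_mul, one_mul, smul_mul_assoc]
    _ = s * o + c • (s * o * s * o * j * r) := by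
        rw [h1, h2, smul_sub]
        abel
    _ = s * o * s * (1 + c • (o * j)) * r := by
        simp only [mul_add, add_mul, mul_one, mul_smul_comm, smul_mul_assoc, h3, ← mul_assoc]

/-- The counterpart for `J`: the `ω`-`J` relation is multiplied by `JR̂` on the right, and the Hecke
relation `R̂² = 1 + cR̂` absorbs the inhomogeneous term. -/
theorem braid_J_W (hrs : r * s = 1) (hc : r = s + c • 1)
    (hjj : j * r * j * r = -(s * j * r * j)) (hoj : o * r * j * r + r * j * r * o = -r) :
    r * j * r * (1 + c • (o * j)) * r = (1 + c • (o * j)) * r * j := by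
  have h0 : r * j * r * j * r = -(j * r * j) := by
    have h := congrArg (r * ·) hjj
    simpa only [mul_assoc, mul_neg, mul_tail hrs] using h
  have h1 : r * j * r * (o * j) * r = o * j * r * j - r * j * r := by
    have h := congrArg (fun z => z * j * r) hoj
    simp only [add_mul, neg_mul] at h
    have e : o * r * j * r * j * r = -(o * j * r * j) := by
      simpa only [mul_assoc, mul_neg] using congrArg (o * ·) h0
    rw [e] at h
    simp only [mul_assoc] at h ⊢
    rw [← sub_eq_zero] at h ⊢
    rw [← h]
    abel
  have h2 : r * j * r * r = r * j + c • (r * j * r) := by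
    have : r * r = 1 + c • r := by
      nth_rewrite 2 [hc]
      rw [mul_add, hrs, mul_smul_comm, mul_one]
    rw [mul_assoc (r * j), this, mul_add, mul_one, mul_smul_comm]
  simp only [add_mul, mul_add, one_mul, mul_one, smul_mul_assoc, mul_smul_comm, h1, h2]
  module

/-- One factor `W` is expanded, and the other is carried past its `ω` and then its `J`. -/
theorem braid_W_W (hrs : r * s = 1) (hsr : s * r = 1) {w : M} (hw : w = 1 + c • (o * j))
    (hwo : w * r * o = s * o * s * w * r) (hjw : r * j * r * w * r = w * r * j) :
    w * r * w * s = s * w * r * w := by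
  have h1 : w * r * (o * j) * s = s * (o * j) * r * w := by
    calc w * r * (o * j) * s = (w * r * o) * j * s := by simp only [mul_assoc]
      _ = s * o * s * (w * r * j) * s := by rw [hwo]; simp only [mul_assoc]
      _ = s * (o * j) * r * w := by
        rw [← hjw]; simp only [mul_assoc, mul_tail hsr, hrs, mul_one]
  calc w * r * w * s = w * r * s + c • (w * r * (o * j) * s) := by
        nth_rewrite 2 [hw]
        simp only [mul_add, add_mul, mul_one, mul_smul_comm, smul_mul_assoc]
    _ = s * r * w + c • (s * (o * j) * r * w) := by
        rw [h1, mul_assoc w, hrs, hsr, mul_one, one_mul]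
    _ = s * (1 + c • (o * j)) * r * w := by
        simp only [mul_add, add_mul, mul_one, mul_smul_comm, smul_mul_assoc]
    _ = s * w * r * w := by rw [← hw]

/-- Here and in the next two lemmas the rule for `W` is multiplied by `V` on both sides to give the
rule for its inverse. -/
theorem braid_om_V (hrs : r * s = 1) {w : M} (hwv : w * v = 1) (hvw : v * w = 1)
    (hwo : w * r * o = s * o * s * w * r) : r * o * s * v = v * s * o * s := by
  have h := congrArg (fun z => v * z * s * v) hwo
  simpa only [mul_assoc, mul_tail hvw, mul_tail hrs, hwv, mul_one] using h

theorem braid_J_V (hrs : r * s = 1) (hsr : s * r = 1) {w : M} (hwv : w * v = 1) (hvw : v * w = 1)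
    (hjw : r * j * r * w * r = w * r * j) : j * s * v = s * v * r * j * r := by
  have h := congrArg (fun z => s * v * z * s * v) hjw
  simp only [mul_assoc, mul_tail hvw, mul_tail hrs, mul_tail hsr, hwv, mul_one] at h
  simp only [mul_assoc]
  exact h.symm

theorem braid_V_V (hrs : r * s = 1) (hsr : s * r = 1) {w : M} (hwv : w * v = 1) (hvw : v * w = 1)
    (hww : w * r * w * s = s * w * r * w) : r * v * s * v = v * s * v * r := by
  have h := congrArg (fun z => v * s * v * r * z * r * v * s * v) hww
  simp only [mul_assoc, mul_tail hvw, mul_tail hrs, mul_tail hsr, hwv, mul_one] at h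
  simp only [mul_assoc]
  exact h.symm

/-- The relation making the quantum trace of `y` commute with `l`. -/
def BraidCommutes (r s l y : M) : Prop := l * r * y * s = s * y * r * l

/-- Inserting `R̂⁻¹R̂` between the factors lets `l` pass them one at a time. With the closure under
`1 + c•` and inverses below, the relation passes from `ω`, `L`, `J` to `V` and `Θ`. -/
theorem BraidCommutes.mul (hrs : r * s = 1) (hsr : s * r = 1) {y z : M}
    (hy : BraidCommutes r s l y) (hz : BraidCommutes r s l z) : BraidCommutes r s l (y * z) := by
  unfold BraidCommutes at *
  calc l * r * (y * z) * s = (l * r * y * s) * r * z * s := by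
        simp only [mul_assoc, mul_tail hsr]
    _ = s * y * r * (l * r * z * s) := by rw [hy]; simp only [mul_assoc]
    _ = s * (y * z) * r * l := by rw [hz]; simp only [mul_assoc, mul_tail hrs]

theorem BraidCommutes.one_add_smul (hrs : r * s = 1) (hsr : s * r = 1) {y : M}
    (hy : BraidCommutes r s l y) : BraidCommutes r s l (1 + c • y) := by
  unfold BraidCommutes at *
  simp only [mul_add, add_mul, mul_one, mul_smul_comm, smul_mul_assoc, hy]
  rw [mul_assoc l, hrs, hsr, mul_one, one_mul]

theorem BraidCommutes.inv (hrs : r * s = 1) (hsr : s * r = 1) {w : M} (hwv : w * v = 1)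
    (hvw : v * w = 1) (hw : BraidCommutes r s l w) : BraidCommutes r s l v := by
  unfold BraidCommutes at *
  have h := congrArg (fun z => s * v * r * z * r * v * s) hw
  simp only [mul_assoc, mul_tail hvw, mul_tail hwv, mul_tail hrs, mul_tail hsr, hrs, mul_one] at h
  simp only [mul_assoc]
  exact h.symm

theorem BraidCommutes.of_rel (hrs : r * s = 1) (hsr : s * r = 1) {y : M}
    (h : y * r * l * r = r * l * r * y) : BraidCommutes r s l y := by
  unfold BraidCommutes
  have h := congrArg (fun z => s * z * s) h
  simp only [mul_assoc, mul_tail hsr, hrs, mul_one] at h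
  simp only [mul_assoc]
  exact h.symm

/-- The right-hand `ω` is moved left through `V` and `L`; only its meeting with the `ω` in `Θ`
produces a sign. -/
theorem braid_theta_om (hsr : s * r = 1)
    (hoo : o * s * o * r = -(s * o * s * o)) (hlo : BraidCommutes r s l o)
    (hov : r * o * s * v = v * s * o * s) :
    o * l * v * s * o = -(s * o * s * (o * l * v) * r) := by
  have h1 : v * s * o = r * o * s * v * r := by rw [hov, mul_assoc _ s r, hsr, mul_one]
  calc o * l * v * s * o = o * l * (v * s * o) := by simp only [mul_assoc]
    _ = o * (l * r * o * s) * v * r := by rw [h1]; simp only [mul_assoc]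
    _ = (o * s * o * r) * l * v * r := by rw [hlo]; simp only [mul_assoc]
    _ = -(s * o * s * (o * l * v) * r) := by rw [hoo]; simp only [mul_assoc, neg_mul]

/-- As `J` moves through `Θ`, the contraction with `ω` yields `-LVR̂⁻¹`, and the factor `R̂² = 1 +
cR̂` yields the last term. After tracing, these two recombine into `-LVW = -L`. -/
theorem braid_J_theta (hrs : r * s = 1) (hsr : s * r = 1) (hc : r = s + c • 1)
    (hoj : o * r * j * r + r * j * r * o = -r) (hjl : j * r * l * r = r * l * r * j)
    (hlo : BraidCommutes r s l o) (hov : r * o * s * v = v * s * o * s)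
    (hjv : j * s * v = s * v * r * j * r) :
    j * r * (o * l * v) * s =
      -(l * v * s) - s * (o * l * v) * r * j - c • (l * v * s * (o * j)) := by
  have h1 : j * r * o * s = -s - s * o * r * j := by
    have h := congrArg (fun z => s * z * s) hoj
    simp only [mul_assoc, mul_add, add_mul, neg_mul, mul_neg, mul_tail hsr, hrs, mul_one] at h
    simp only [mul_assoc]
    rw [eq_sub_iff_add_eq, ← h]
    abel
  have h2 : j * r * l = r * l * r * j * s := by rw [← hjl, mul_assoc _ r s, hrs, mul_one]
  have h3 : r * j * s * v * s = v * r * j := by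
    rw [mul_assoc r j s, mul_assoc r (j * s) v, hjv]
    simp only [mul_assoc, mul_tail hrs, hrs, mul_one]
  have h4 : r * r = 1 + c • r := by
    nth_rewrite 2 [hc]
    rw [mul_add, hrs, mul_smul_comm, mul_one]
  calc j * r * (o * l * v) * s = (j * r * o * s) * r * l * v * s := by
        simp only [mul_assoc, mul_tail hsr]
    _ = -(l * v * s) - s * o * r * (j * r * l) * v * s := by
        rw [h1]; simp only [mul_assoc, sub_mul, neg_mul, mul_tail hsr]
    _ = -(l * v * s) - s * o * r * r * l * (r * j * s * v * s) := by
        rw [h2]; simp only [mul_assoc]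
    _ = -(l * v * s) - s * o * (r * r) * l * v * r * j := by
        rw [h3]; simp only [mul_assoc]
    _ = -(l * v * s) - s * (o * l * v) * r * j - c • ((s * o * r * l) * v * r * j) := by
        rw [h4]
        simp only [mul_assoc, mul_add, add_mul, one_mul, mul_smul_comm, smul_mul_assoc]
        abel
    _ = -(l * v * s) - s * (o * l * v) * r * j - c • (l * (r * o * s * v) * r * j) := by
        rw [← hlo]; simp only [mul_assoc]
    _ = -(l * v * s) - s * (o * l * v) * r * j - c • (l * v * s * (o * j)) := by
        rw [hov]; simp only [mul_assoc, mul_tail hsr]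

/-- The second `Θ` is split into `ω`, `L`, `V`, and the first is carried past each. Thus `Θ`
inherits the relation of `ω`, so that its trace also squares to zero. -/
theorem braid_theta_theta (hrs : r * s = 1) (hsr : s * r = 1)
    (hto : o * l * v * s * o = -(s * o * s * (o * l * v) * r))
    (hlt : BraidCommutes r s l (o * l * v)) (hlv : BraidCommutes r s l v)
    (hov : r * o * s * v = v * s * o * s) (hvv : r * v * s * v = v * s * v * r) :
    (o * l * v) * s * (o * l * v) * r = -(s * (o * l * v) * s * (o * l * v)) := by
  have h1 : r * (o * l * v) * s * v = v * s * (o * l * v) * s := by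
    have e1 : v * s * v = r * v * s * v * s := by rw [hvv, mul_assoc _ r s, hrs, mul_one]
    have e2 : l * v * s * v = s * v * r * l * v * s := by
      calc l * v * s * v = l * (v * s * v) := by simp only [mul_assoc]
        _ = (l * r * v * s) * v * s := by rw [e1]; simp only [mul_assoc]
        _ = s * v * r * l * v * s := by rw [hlv]
    calc r * (o * l * v) * s * v = r * o * (l * v * s * v) := by simp only [mul_assoc]
      _ = (r * o * s * v) * r * l * v * s := by rw [e2]; simp only [mul_assoc]
      _ = v * s * (o * l * v) * s := by rw [hov]; simp only [mul_assoc, mul_tail hsr]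
  unfold BraidCommutes at hlt
  generalize ht : o * l * v = t at *
  have h2 : t * r * l = r * l * r * t * s := by
    simpa only [mul_assoc, mul_tail hrs] using congrArg (r * ·) hlt.symm
  have h3 : t * s * t = -(s * t * s * t * s) := by
    calc t * s * t = t * s * o * l * v := by rw [← ht]; simp only [mul_assoc]
      _ = -(s * o * s * (t * r * l) * v) := by rw [hto]; simp only [mul_assoc, neg_mul]
      _ = -(s * o * l * (r * t * s * v)) := by rw [h2]; simp only [mul_assoc, mul_tail hsr]
      _ = -(s * (o * l * v) * s * t * s) := by rw [h1]; simp only [mul_assoc]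
      _ = -(s * t * s * t * s) := by rw [ht]
  rw [h3]
  simp only [mul_assoc, neg_mul, hsr, mul_one]

end BraidedIdentities

/-! ### Traces of matrices obeying the odd reflection relation -/

section QuantumTrace

variable {K : Type*} [Field K] {A : Type*} [Ring A] [Algebra K A] {N : ℕ} {q : K}

theorem diagonal_const_mul (x : A) (Y : Matrix (Fin N) (Fin N) A) (i j : Fin N) :
    ((Matrix.diagonal fun _ => x : Matrix (Fin N) (Fin N) A) * Y) i j = x * Y i j := by
  simp [Matrix.diagonal_mul]

theorem mul_diagonal_const (x : A) (Y : Matrix (Fin N) (Fin N) A) (i j : Fin N) :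
    (Y * (Matrix.diagonal fun _ => x : Matrix (Fin N) (Fin N) A)) i j = Y i j * x := by
  simp [Matrix.mul_diagonal]

theorem qTrace_mul_right (Y : Matrix (Fin N) (Fin N) A) (x : A) :
    qTrace q (Y * Matrix.diagonal fun _ => x) = qTrace q Y * x := by
  simp [qTrace_eq, Finset.sum_mul]

theorem qTrace_mul_left (Y : Matrix (Fin N) (Fin N) A) (x : A) :
    qTrace q ((Matrix.diagonal fun _ => x) * Y) = x * qTrace q Y := by
  simp [qTrace_eq, Finset.mul_sum]

theorem qTrace_add (Y Z : Matrix (Fin N) (Fin N) A) :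
    qTrace q (Y + Z) = qTrace q Y + qTrace q Z := by
  simp [qTrace_eq, Finset.sum_add_distrib]

theorem qTrace_neg (Y : Matrix (Fin N) (Fin N) A) : qTrace q (-Y) = -qTrace q Y := by
  simp [qTrace_eq]

theorem qTrace_sub (Y Z : Matrix (Fin N) (Fin N) A) :
    qTrace q (Y - Z) = qTrace q Y - qTrace q Z := by
  simp [qTrace_eq, smul_sub]

theorem qTrace_smul (c : K) (Y : Matrix (Fin N) (Fin N) A) :
    qTrace q (c • Y) = c • qTrace q Y := by
  simp [qTrace_eq, Finset.smul_sum, smul_comm c]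

theorem rH_eq_rHinv_add (hq0 : q ≠ 0) : rH A N q = rHinv A N q + lam q • 1 := by
  rw [rHinv_eq hq0]; abel

/-- Replacing the right `R̂` by `R̂⁻¹` costs `-λX`. This defect is the source of `Tω` and `ω²` in
the action of `Q`. -/
theorem qTrace1_rHinv_leg2_rHinv (hq0 : q ≠ 0) (X : Matrix (Fin N) (Fin N) A) :
    qTrace1 q (rHinv A N q * leg2 X * rHinv A N q) =
      (Matrix.diagonal fun _ => qTrace q X) - lam q • X := by
  have h : rHinv A N q * leg2 X * rHinv A N q =
      rHinv A N q * leg2 X * rH A N q - lam q • (rHinv A N q * leg2 X) := by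
    rw [rH_eq_rHinv_add hq0, mul_add, mul_smul_comm, mul_one]; abel
  rw [h, qTrace1_sub, qTrace1_rHinv_leg2_rH hq0, qTrace1_smul, qTrace1_mul_leg2, qTrace1_rHinv hq0,
    one_mul]

/-- The `ω`-`ω` relation, for a matrix `X`. -/
def ReflectionOdd (q : K) (X : Matrix (Fin N) (Fin N) A) : Prop :=
  leg2 X * rHinv A N q * leg2 X * rH A N q = -(rHinv A N q * leg2 X * rHinv A N q * leg2 X)

theorem ReflectionOdd.anticomm (hq0 : q ≠ 0) {X : Matrix (Fin N) (Fin N) A}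
    (h : ReflectionOdd q X) :
    (Matrix.diagonal fun _ => qTrace q X) * X + X * (Matrix.diagonal fun _ => qTrace q X) =
      lam q • (X * X) := by
  have h1 := congrArg (qTrace1 q) h
  rw [qTrace1_neg, qTrace1_mul_leg2, qTrace1_rHinv_leg2_rHinv hq0, mul_assoc, mul_assoc,
    qTrace1_leg2_mul, ← mul_assoc, qTrace1_rHinv_leg2_rH hq0] at h1
  rw [h1, sub_mul, smul_mul_assoc]
  abel

/-- The expression is `(q + q⁻¹)²`, and `q² = -1` would force `q⁴ = 1`. -/
theorem lam_sq_add_four_ne_zero (hq0 : q ≠ 0) (hq : ∀ n : ℕ, 0 < n → q ^ n ≠ 1) :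
    lam q * lam q + 4 ≠ 0 := by
  intro h
  have h1 : q ^ 2 * (lam q * lam q + 4) = (q ^ 2 + 1) ^ 2 := by
    simp only [lam]; field_simp; ring
  rw [h, mul_zero] at h1
  have h2 : q ^ 2 + 1 = 0 := by simpa using h1.symm
  exact hq 4 (by norm_num) (by linear_combination (q ^ 2 - 1) * h2)

theorem lam_ne_zero (hq0 : q ≠ 0) (hq : ∀ n : ℕ, 0 < n → q ^ n ≠ 1) : lam q ≠ 0 := by
  intro h
  refine hq 2 (by norm_num) ?_
  have h1 : q * lam q = q ^ 2 - 1 := by simp only [lam]; field_simp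
  rw [h, mul_zero] at h1
  exact (sub_eq_zero.mp h1.symm)

/-- With `B = X₂R̂⁻¹X₂`, let `a` and `b` be the full quantum traces of `B` and `BR̂`; here `a = Tr_q
X²`. The relation says `BR̂ = -R̂⁻¹B`. Cyclicity in `R̂` and the Hecke condition turn it into `λa =
2b` and `λb + 2a = 0`, hence `(λ² + 4)a = 0`. -/
theorem ReflectionOdd.qTrace_sq (hq0 : q ≠ 0) (hq : ∀ n : ℕ, 0 < n → q ^ n ≠ 1)
    {X : Matrix (Fin N) (Fin N) A} (h : ReflectionOdd q X) : qTrace q (X * X) = 0 := by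
  set r := rH A N q with hr
  set s := rHinv A N q with hs
  have hrs : r * s = 1 := rH_mul_rHinv hq0
  have hrr : r * r = lam q • r + 1 := rH_mul_rH hq0
  set B := leg2 X * s * leg2 X with hB
  have hBr : r * (B * r) = -B := by
    have h1 : B * r = -(s * B) := by
      rw [hB]; unfold ReflectionOdd at h; rw [h]; simp only [mul_assoc]; rfl
    rw [h1, mul_neg, ← mul_assoc, hrs, one_mul]
  have e1 := qTrace_qTrace1_rH_comm q (B * r)
  have e2 := qTrace_qTrace1_rH_comm q B
  rw [← hr, hBr, mul_assoc, hrr, mul_add, mul_one, mul_smul_comm, qTrace1_neg, qTrace1_add,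
    qTrace1_smul, qTrace_neg, qTrace_add, qTrace_smul] at e1
  have e3 : lam q • qTrace q (qTrace1 q B) = (2 : K) • qTrace q (qTrace1 q (B * r)) := by
    have h1 : s * B = r * B - lam q • B := by
      rw [hs, rHinv_eq hq0, sub_mul, smul_mul_assoc, one_mul]
    have h2 : B * r = -(s * B) := by
      rw [hB]; unfold ReflectionOdd at h; rw [h]; simp only [mul_assoc]; rfl
    rw [h1] at h2
    have h3 := congrArg (fun z => qTrace q (qTrace1 q z)) h2
    simp only [qTrace1_neg, qTrace1_sub, qTrace1_smul, qTrace_neg, qTrace_sub, qTrace_smul] at h3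
    rw [e2] at h3
    have h4 : lam q • qTrace q (qTrace1 q B) =
        qTrace q (qTrace1 q (B * r)) + qTrace q (qTrace1 q (B * r)) := by
      nth_rewrite 1 [h3]; abel
    rw [h4, two_smul]
  have hB1 : qTrace1 q B = X * X := by
    rw [hB, qTrace1_mul_leg2, qTrace1_leg2_mul, qTrace1_rHinv hq0, mul_one]
  rw [hB1] at e1 e3
  have e4 : (lam q * lam q + 4) • qTrace q (X * X) = 0 := by
    rw [add_smul, mul_smul, e3]
    have : (4 : K) • qTrace q (X * X) = (2 : K) • ((2 : K) • qTrace q (X * X)) := by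
      rw [smul_smul]; norm_num
    rw [this, smul_comm, ← smul_add]
    have h5 : lam q • qTrace q (qTrace1 q (B * r)) + (2 : K) • qTrace q (X * X) = 0 := by
      rw [two_smul, ← add_assoc, ← e1]; abel
    rw [h5, smul_zero]
  exact (smul_eq_zero.mp e4).resolve_left (lam_sq_add_four_ne_zero hq0 hq)

variable [CharZero K]

/-- Tracing the anticommutator of `Tr_q X` with `X` gives `2(Tr_q X)² = λ Tr_q X² = 0`. -/
theorem ReflectionOdd.sq_qTrace (hq0 : q ≠ 0) (hq : ∀ n : ℕ, 0 < n → q ^ n ≠ 1)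
    {X : Matrix (Fin N) (Fin N) A} (h : ReflectionOdd q X) : qTrace q X * qTrace q X = 0 := by
  have h1 := congrArg (qTrace q) (h.anticomm hq0)
  rw [qTrace_add, qTrace_mul_left, qTrace_mul_right, qTrace_smul, h.qTrace_sq hq0 hq, smul_zero]
    at h1
  have h2 : (2 : K) • (qTrace q X * qTrace q X) = 0 := by rw [two_smul, h1]
  exact (smul_eq_zero.mp h2).resolve_left two_ne_zero

end QuantumTrace

/-! ### Commutation of `Tr_q ω` and `Tr_q Θ` with the generators -/

section Brst

variable {K : Type*} [Field K] {A : Type*} [Ring A] [Algebra K A] {N : ℕ}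

/-- The commutation relations of the matrices `T`, `T⁻¹`, `L`, `ω`, `J`. -/
structure BrstRelations (q : K) (T T' L ω J : Matrix (Fin N) (Fin N) A) : Prop where
  T_T' : T * T' = 1
  T'_T : T' * T = 1
  T_T : rH A N q * leg1 T * leg2 T = leg1 T * leg2 T * rH A N q
  om_om : leg2 ω * rHinv A N q * leg2 ω * rH A N q =
    -(rHinv A N q * leg2 ω * rHinv A N q * leg2 ω)
  om_L : leg2 ω * rH A N q * leg2 L * rH A N q = rH A N q * leg2 L * rH A N q * leg2 ω
  om_J : leg2 ω * rH A N q * leg2 J * rH A N q + rH A N q * leg2 J * rH A N q * leg2 ω =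
    -(rH A N q)
  L_L : leg2 L * rH A N q * leg2 L * rH A N q = rH A N q * leg2 L * rH A N q * leg2 L
  J_L : leg2 J * rH A N q * leg2 L * rH A N q = rH A N q * leg2 L * rH A N q * leg2 J
  J_J : leg2 J * rH A N q * leg2 J * rH A N q = -(rHinv A N q * leg2 J * rH A N q * leg2 J)
  om_T : leg1 ω * leg2 T = leg2 T * rHinv A N q * leg2 ω * rHinv A N q
  J_T : leg1 J * leg2 T = leg2 T * rH A N q * leg2 J * rH A N q
  L_T : leg1 L * leg2 T = leg2 T * rH A N q * leg2 L * rH A N q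

namespace BrstRelations

variable {q : K} {T T' L ω J V : Matrix (Fin N) (Fin N) A}

theorem leg2_W : leg2 (1 + lam q • (ω * J)) = 1 + lam q • (leg2 ω * leg2 J) := by
  rw [leg2_add, leg2_one, leg2_smul, leg2_mul]

theorem leg2_eq_one {X Y : Matrix (Fin N) (Fin N) A} (h : X * Y = 1) : leg2 X * leg2 Y = 1 := by
  rw [← leg2_mul, h, leg2_one]

theorem leg1_eq_one {X Y : Matrix (Fin N) (Fin N) A} (h : X * Y = 1) : leg1 X * leg1 Y = 1 := by
  rw [← leg1_mul, h, leg1_one]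

variable (h : BrstRelations q T T' L ω J) (hq0 : q ≠ 0)
include h hq0

theorem W_om : (1 + lam q • (leg2 ω * leg2 J)) * rH A N q * leg2 ω =
    rHinv A N q * leg2 ω * rHinv A N q * (1 + lam q • (leg2 ω * leg2 J)) * rH A N q :=
  braid_W_om (rHinv_mul_rH hq0) (rH_eq_rHinv_add hq0) h.om_om h.om_J

theorem J_W : rH A N q * leg2 J * rH A N q * (1 + lam q • (leg2 ω * leg2 J)) * rH A N q =
    (1 + lam q • (leg2 ω * leg2 J)) * rH A N q * leg2 J :=
  braid_J_W (rH_mul_rHinv hq0) (rH_eq_rHinv_add hq0) h.J_J h.om_J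

theorem braidCommutes_om : BraidCommutes (rH A N q) (rHinv A N q) (leg2 L) (leg2 ω) :=
  .of_rel (rH_mul_rHinv hq0) (rHinv_mul_rH hq0) h.om_L

theorem braidCommutes_J : BraidCommutes (rH A N q) (rHinv A N q) (leg2 L) (leg2 J) :=
  .of_rel (rH_mul_rHinv hq0) (rHinv_mul_rH hq0) h.J_L

theorem braidCommutes_L : BraidCommutes (rH A N q) (rHinv A N q) (leg2 L) (leg2 L) :=
  .of_rel (rH_mul_rHinv hq0) (rHinv_mul_rH hq0) h.L_L

omit h in
theorem qTrace_commutes_L {Y : Matrix (Fin N) (Fin N) A}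
    (hY : BraidCommutes (rH A N q) (rHinv A N q) (leg2 L) (leg2 Y)) :
    L * (Matrix.diagonal fun _ => qTrace q Y) = (Matrix.diagonal fun _ => qTrace q Y) * L := by
  have h1 := congrArg (qTrace1 q) hY
  rwa [qTrace1_mul_leg2, qTrace1_rHinv_leg2_rH hq0, mul_assoc, mul_assoc, qTrace1_leg2_mul,
    ← mul_assoc, qTrace1_rH_leg2_rHinv hq0] at h1

variable (hWV : (1 + lam q • (ω * J)) * V = 1) (hVW : V * (1 + lam q • (ω * J)) = 1)
include hWV hVW

theorem braidCommutes_V : BraidCommutes (rH A N q) (rHinv A N q) (leg2 L) (leg2 V) := by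
  have hrs := rH_mul_rHinv (A := A) (N := N) hq0
  have hsr := rHinv_mul_rH (A := A) (N := N) hq0
  refine BraidCommutes.inv hrs hsr (leg2_eq_one hWV) (leg2_eq_one hVW) ?_
  rw [leg2_W]
  exact .one_add_smul hrs hsr (.mul hrs hsr (h.braidCommutes_om hq0) (h.braidCommutes_J hq0))

theorem braidCommutes_theta :
    BraidCommutes (rH A N q) (rHinv A N q) (leg2 L) (leg2 (ω * L * V)) := by
  have hrs := rH_mul_rHinv (A := A) (N := N) hq0
  have hsr := rHinv_mul_rH (A := A) (N := N) hq0
  rw [leg2_mul, leg2_mul]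
  exact .mul hrs hsr (.mul hrs hsr (h.braidCommutes_om hq0) (h.braidCommutes_L hq0))
    (h.braidCommutes_V hq0 hWV hVW)

theorem om_V : rH A N q * leg2 ω * rHinv A N q * leg2 V =
    leg2 V * rHinv A N q * leg2 ω * rHinv A N q := by
  have h1 := leg2_eq_one hWV
  have h2 := leg2_eq_one hVW
  rw [leg2_W] at h1 h2
  exact braid_om_V (rH_mul_rHinv hq0) h1 h2 (h.W_om hq0)

theorem theta_om : leg2 (ω * L * V) * rHinv A N q * leg2 ω =
    -(rHinv A N q * leg2 ω * rHinv A N q * leg2 (ω * L * V) * rH A N q) := by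
  rw [leg2_mul, leg2_mul]
  exact braid_theta_om (rHinv_mul_rH hq0) h.om_om (h.braidCommutes_om hq0) (h.om_V hq0 hWV hVW)

theorem reflectionOdd_theta : ReflectionOdd q (ω * L * V) := by
  have hrs := rH_mul_rHinv (A := A) (N := N) hq0
  have hsr := rHinv_mul_rH (A := A) (N := N) hq0
  have h1 := leg2_eq_one hWV
  have h2 := leg2_eq_one hVW
  rw [leg2_W] at h1 h2
  have hto := h.theta_om hq0 hWV hVW
  have hlt := h.braidCommutes_theta hq0 hWV hVW
  unfold ReflectionOdd
  rw [leg2_mul, leg2_mul] at *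
  exact braid_theta_theta hrs hsr hto hlt (h.braidCommutes_V hq0 hWV hVW) (h.om_V hq0 hWV hVW)
    (braid_V_V hrs hsr h1 h2 (braid_W_W hrs hsr rfl (h.W_om hq0) (h.J_W hq0)))

/-- A factor `R̂` is put on the left before tracing, so that `Θ` is conjugated by `R̂` on one side
and by `R̂⁻¹` on the other. -/
theorem qTrace_theta_om : (Matrix.diagonal fun _ => qTrace q (ω * L * V)) * ω =
    -(ω * (Matrix.diagonal fun _ => qTrace q (ω * L * V))) := by
  have h1 := congrArg (fun z => qTrace1 q (rH A N q * z)) (h.theta_om hq0 hWV hVW)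
  simp only [mul_neg, qTrace1_neg] at h1
  rw [← mul_assoc, qTrace1_mul_leg2, ← mul_assoc, qTrace1_rH_leg2_rHinv hq0] at h1
  have hrs := rH_mul_rHinv (A := A) (N := N) hq0
  rw [h1]
  generalize ω * L * V = Θ
  simp only [mul_assoc, mul_tail hrs]
  rw [qTrace1_leg2_mul, ← mul_assoc (rHinv A N q), qTrace1_rHinv_leg2_rH hq0]

theorem qTrace_theta_J : (Matrix.diagonal fun _ => qTrace q (ω * L * V)) * J +
    J * (Matrix.diagonal fun _ => qTrace q (ω * L * V)) = -L := by
  have hrs := rH_mul_rHinv (A := A) (N := N) hq0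
  have hsr := rHinv_mul_rH (A := A) (N := N) hq0
  have h1 := leg2_eq_one hWV
  have h2 := leg2_eq_one hVW
  rw [leg2_W] at h1 h2
  have key := braid_J_theta hrs hsr (rH_eq_rHinv_add hq0) h.om_J h.J_L (h.braidCommutes_om hq0)
    (h.om_V hq0 hWV hVW) (braid_J_V hrs hsr h1 h2 (h.J_W hq0))
  simp only [← leg2_mul] at key
  have e := congrArg (qTrace1 q) key
  rw [qTrace1_sub, qTrace1_sub, qTrace1_neg, qTrace1_smul, qTrace1_mul_leg2, qTrace1_mul_leg2,
    qTrace1_rHinv_leg2_rH hq0, qTrace1_leg2_mul, qTrace1_rHinv hq0, mul_assoc, mul_assoc,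
    qTrace1_leg2_mul, ← mul_assoc (rH A N q), qTrace1_rH_leg2_rHinv hq0] at e
  rw [e]
  generalize qTrace q (ω * L * V) = x
  -- The contraction term `LV` and the Hecke term `λLVωJ` form `LVW`.
  have e2 : L * V * (1 + lam q • (ω * J)) = L := by rw [mul_assoc, hVW, mul_one]
  rw [mul_add, mul_one, mul_smul_comm] at e2
  nth_rewrite 3 [← e2]
  rw [mul_one]
  abel

omit hWV hVW in
theorem qTrace_om_J : (Matrix.diagonal fun _ => qTrace q ω) * J +
    J * (Matrix.diagonal fun _ => qTrace q ω) = -1 := by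
  have hrs := rH_mul_rHinv (A := A) (N := N) hq0
  have hsr := rHinv_mul_rH (A := A) (N := N) hq0
  -- Multiplying by `R̂⁻¹` on both sides makes `ω` a conjugate in each term and turns the right side
  -- into `-R̂⁻¹`.
  have h1 := congrArg (fun z => qTrace1 q (rHinv A N q * z * rHinv A N q)) h.om_J
  simp only [mul_add, add_mul, mul_neg, neg_mul, hsr, one_mul, qTrace1_neg, qTrace1_add,
    qTrace1_rHinv hq0] at h1
  rw [← h1]
  congr 1
  · simp only [mul_assoc, hrs, mul_one]
    rw [← mul_assoc, ← mul_assoc, qTrace1_mul_leg2, qTrace1_rHinv_leg2_rH hq0]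
  · simp only [mul_assoc, mul_tail hsr]
    rw [qTrace1_leg2_mul, ← mul_assoc, qTrace1_rH_leg2_rHinv hq0]

omit hWV hVW in
theorem qTrace_om_T : (Matrix.diagonal fun _ => qTrace q ω) * T =
    T * (Matrix.diagonal fun _ => qTrace q ω) - lam q • (T * ω) := by
  have h1 := congrArg (qTrace1 q) h.om_T
  rw [qTrace1_mul_leg2, qTrace1_leg1, mul_assoc, mul_assoc, qTrace1_leg2_mul, ← mul_assoc,
    qTrace1_rHinv_leg2_rHinv hq0] at h1
  rw [h1, mul_sub, mul_smul_comm]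

/-- Passing `T` puts `R̂⁻¹` on both sides of `ω`, but `R̂` on both sides of `L` and `J`. The inner
factors cancel in `ωL` and `ωJ`, so these, `V` and `Θ` are simply conjugated, without the defect
seen for `ω`. -/
theorem qTrace_theta_T : (Matrix.diagonal fun _ => qTrace q (ω * L * V)) * T =
    T * (Matrix.diagonal fun _ => qTrace q (ω * L * V)) := by
  have hrs := rH_mul_rHinv (A := A) (N := N) hq0
  have hsr := rHinv_mul_rH (A := A) (N := N) hq0
  have e1 : leg1 (ω * L) * leg2 T = leg2 T * rHinv A N q * leg2 (ω * L) * rH A N q := by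
    rw [leg1_mul, mul_assoc, h.L_T]
    simp only [← mul_assoc]
    rw [h.om_T]
    simp only [leg2_mul, mul_assoc, mul_tail hsr]
  have e2 : leg1 (ω * J) * leg2 T = leg2 T * rHinv A N q * leg2 (ω * J) * rH A N q := by
    rw [leg1_mul, mul_assoc, h.J_T]
    simp only [← mul_assoc]
    rw [h.om_T]
    simp only [leg2_mul, mul_assoc, mul_tail hsr]
  have e3 : leg1 (1 + lam q • (ω * J)) * leg2 T =
      leg2 T * rHinv A N q * leg2 (1 + lam q • (ω * J)) * rH A N q := by
    rw [leg1_add, leg1_one, leg1_smul, leg2_add, leg2_one, leg2_smul, add_mul, smul_mul_assoc, e2]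
    simp only [mul_add, add_mul, one_mul, mul_one, mul_smul_comm, smul_mul_assoc]
    rw [mul_assoc (leg2 T) (rHinv A N q) (rH A N q), hsr, mul_one]
  have e4 : leg1 V * leg2 T = leg2 T * rHinv A N q * leg2 V * rH A N q := by
    have e := congrArg (fun z => leg1 V * z * rHinv A N q * leg2 V * rH A N q) e3
    simp only [mul_assoc, mul_tail (leg1_eq_one hVW), mul_tail hrs, mul_tail (leg2_eq_one hWV),
      hsr, mul_one] at e
    simp only [mul_assoc]
    exact e.symm
  have e5 : leg1 (ω * L * V) * leg2 T = leg2 T * rHinv A N q * leg2 (ω * L * V) * rH A N q := by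
    rw [leg1_mul, mul_assoc, e4]
    simp only [← mul_assoc]
    rw [e1]
    simp only [leg2_mul, mul_assoc, mul_tail hrs]
  generalize ω * L * V = Θ at e5 ⊢
  have e6 := congrArg (qTrace1 q) e5
  rwa [qTrace1_mul_leg2, qTrace1_leg1, mul_assoc, mul_assoc, qTrace1_leg2_mul, ← mul_assoc,
    qTrace1_rHinv_leg2_rH hq0] at e6

end BrstRelations

end Brst

/-! ### From matrix relations to inclusions of spans of entries -/

section Entries

variable {K : Type*} [Field K] {A : Type*} [Ring A] [Algebra K A] {N : ℕ} {q : K}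

/-- All entries of the matrix `X` lie in the subspace `S`. -/
def EntriesIn {m n : Type*} (S : Submodule K A) (X : Matrix m n A) : Prop := ∀ i j, X i j ∈ S

variable (K) in
/-- The linear span of the entries of a matrix. -/
def entries {m n : Type*} (X : Matrix m n A) : Submodule K A :=
  Submodule.span K {x | ∃ i j, x = X i j}

theorem entriesIn_entries {m n : Type*} (X : Matrix m n A) : EntriesIn (entries K X) X :=
  fun i j => Submodule.subset_span ⟨i, j, rfl⟩

theorem entries_le {m n : Type*} {X : Matrix m n A} {S : Submodule K A} (h : EntriesIn S X) :
    entries K X ≤ S := by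
  refine Submodule.span_le.mpr ?_
  rintro _ ⟨i, j, rfl⟩
  exact h i j

namespace EntriesIn

variable {l m n : Type*} {S S' : Submodule K A}

theorem mono {X : Matrix m n A} (h : EntriesIn S X) (hS : S ≤ S') : EntriesIn S' X :=
  fun i j => hS (h i j)

theorem mul [Fintype m] {X : Matrix l m A} {Y : Matrix m n A} (hX : EntriesIn S X)
    (hY : EntriesIn S' Y) : EntriesIn (S * S') (X * Y) := fun i j => by
  rw [Matrix.mul_apply]
  exact Submodule.sum_mem _ fun k _ => Submodule.mul_mem_mul (hX i k) (hY k j)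

theorem add {X Y : Matrix m n A} (hX : EntriesIn S X) (hY : EntriesIn S Y) : EntriesIn S (X + Y) :=
  fun i j => S.add_mem (hX i j) (hY i j)

theorem sub {X Y : Matrix m n A} (hX : EntriesIn S X) (hY : EntriesIn S Y) : EntriesIn S (X - Y) :=
  fun i j => S.sub_mem (hX i j) (hY i j)

theorem neg {X : Matrix m n A} (hX : EntriesIn S X) : EntriesIn S (-X) :=
  fun i j => S.neg_mem (hX i j)

theorem smul (c : K) {X : Matrix m n A} (hX : EntriesIn S X) : EntriesIn S (c • X) :=
  fun i j => S.smul_mem c (hX i j)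

theorem one [DecidableEq m] : EntriesIn (1 : Submodule K A) (1 : Matrix m m A) := fun i j => by
  rw [Matrix.one_apply]
  split_ifs
  · exact Submodule.one_le.mp le_rfl
  · exact Submodule.zero_mem _

theorem leg1 {X : Matrix (Fin N) (Fin N) A} (h : EntriesIn S X) : EntriesIn S (leg1 X) := by
  rintro ⟨i1, i2⟩ ⟨j1, j2⟩
  by_cases hi : i2 = j2
  · simpa [GLq.leg1, hi] using h i1 j1
  · simp [GLq.leg1, hi]

theorem leg2 {X : Matrix (Fin N) (Fin N) A} (h : EntriesIn S X) : EntriesIn S (leg2 X) := by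
  rintro ⟨i1, i2⟩ ⟨j1, j2⟩
  by_cases hi : i1 = j1
  · simpa [GLq.leg2, hi] using h i2 j2
  · simp [GLq.leg2, hi]

theorem rH_mul {Y : Matrix (Fin N × Fin N) n A} (h : EntriesIn S Y) :
    EntriesIn S (rH A N q * Y) := by
  rintro ⟨i1, i2⟩ j
  rw [rH_mul_apply]
  exact S.add_mem (S.smul_mem _ (h _ _)) (S.smul_mem _ (h _ _))

theorem mul_rH {Y : Matrix n (Fin N × Fin N) A} (h : EntriesIn S Y) :
    EntriesIn S (Y * rH A N q) := by
  rintro i ⟨j1, j2⟩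
  rw [mul_rH_apply]
  exact S.add_mem (S.smul_mem _ (h _ _)) (S.smul_mem _ (h _ _))

theorem rHinv_mul (hq0 : q ≠ 0) {Y : Matrix (Fin N × Fin N) n A} (h : EntriesIn S Y) :
    EntriesIn S (rHinv A N q * Y) := by
  rintro ⟨i1, i2⟩ j
  rw [rHinv_mul_apply hq0]
  exact S.sub_mem (S.smul_mem _ (h _ _)) (S.smul_mem _ (h _ _))

theorem qTrace1 {Y : Matrix (Fin N × Fin N) (Fin N × Fin N) A} (h : EntriesIn S Y) :
    EntriesIn S (qTrace1 q Y) := fun i j => by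
  rw [GLq.qTrace1, Matrix.of_apply]
  exact S.sum_mem fun _ _ => S.smul_mem _ (h _ _)

theorem qTrace_mem {X : Matrix (Fin N) (Fin N) A} (h : EntriesIn S X) : qTrace q X ∈ S := by
  rw [qTrace_eq]
  exact S.sum_mem fun _ _ => S.smul_mem _ (h _ _)

end EntriesIn

theorem leg2_rH_leg2_apply (X Y : Matrix (Fin N) (Fin N) A) (a b i j : Fin N) :
    (leg2 X * (rH A N q * leg2 Y)) (b, i) (a, j) = (if a = b then q else 1) • (X i a * Y b j) +
      if a = b then ∑ k, (if b < k then lam q else 0) • (X i k * Y k j) else 0 := by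
  rw [leg2_mul_apply]
  simp only [rH_mul_apply, mul_add, Finset.sum_add_distrib, leg2, Matrix.kroneckerMap_apply,
    Matrix.one_apply, mul_smul_comm, ite_mul, one_mul, zero_mul, mul_ite, mul_zero]
  congr 1
  · rw [Finset.sum_eq_single a]
    · simp [eq_comm]
    · intro k _ hk; simp [hk]
    · simp
  · by_cases h : a = b
    · simp [h]
    · simp [h, Ne.symm h]

theorem leg2_rHinv_leg2_apply (hq0 : q ≠ 0) (X Y : Matrix (Fin N) (Fin N) A) (a b i j : Fin N) :
    (leg2 X * (rHinv A N q * leg2 Y)) (b, i) (a, j) =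
      (if a = b then q⁻¹ else 1) • (X i a * Y b j) -
      if a = b then ∑ k, (if k < b then lam q else 0) • (X i k * Y k j) else 0 := by
  rw [leg2_mul_apply]
  simp only [rHinv_mul_apply hq0, mul_sub, Finset.sum_sub_distrib, leg2,
    Matrix.kroneckerMap_apply,
    Matrix.one_apply, mul_smul_comm, ite_mul, one_mul, zero_mul, mul_ite, mul_zero]
  congr 1
  · rw [Finset.sum_eq_single a]
    · simp [eq_comm]
    · intro k _ hk; simp [hk]
    · simp
  · by_cases h : a = b
    · simp [h]
    · simp [h, Ne.symm h]

/-- Skew invertibility of `R̂`: the products of entries are determined by `X₂ R̂ Y₂`. -/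
theorem mul_entries_le_of_rH (hq0 : q ≠ 0) {X Y : Matrix (Fin N) (Fin N) A} {S : Submodule K A}
    (h : EntriesIn S (leg2 X * (rH A N q * leg2 Y))) : entries K X * entries K Y ≤ S := by
  -- The diagonal entry contains `q X i a * Y a j` plus a tail over `k > a`, so the system is
  -- triangular and is solved by descending induction on `a`.
  have h0 : ∀ a i j, X i a * Y a j ∈ S := by
    intro a i j
    induction a using WellFoundedGT.induction with
    | ind a ih =>
      have h1 := h (a, i) (a, j)
      rw [leg2_rH_leg2_apply, if_pos rfl, if_pos rfl] at h1
      rw [← Submodule.smul_mem_iff S hq0]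
      refine (Submodule.add_mem_iff_left S ?_).mp h1
      refine S.sum_mem fun k _ => ?_
      split_ifs with hk
      · exact S.smul_mem _ (ih k hk)
      · simp
  rw [entries, entries, Submodule.span_mul_span]
  refine Submodule.span_le.mpr ?_
  rintro _ ⟨_, ⟨i, a, rfl⟩, _, ⟨b, j, rfl⟩, rfl⟩
  by_cases hab : a = b
  · subst hab; exact h0 a i j
  · have h1 := h (b, i) (a, j)
    rwa [leg2_rH_leg2_apply, if_neg hab, if_neg hab, one_smul, add_zero] at h1

/-- Skew invertibility of `R̂⁻¹`. -/
theorem mul_entries_le_of_rHinv (hq0 : q ≠ 0) {X Y : Matrix (Fin N) (Fin N) A} {S : Submodule K A}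
    (h : EntriesIn S (leg2 X * (rHinv A N q * leg2 Y))) : entries K X * entries K Y ≤ S := by
  -- Now the tail runs over `k < a`, and the induction ascends.
  have h0 : ∀ a i j, X i a * Y a j ∈ S := by
    intro a i j
    induction a using WellFoundedLT.induction with
    | ind a ih =>
      have h1 := h (a, i) (a, j)
      rw [leg2_rHinv_leg2_apply hq0, if_pos rfl, if_pos rfl] at h1
      rw [← Submodule.smul_mem_iff S (inv_ne_zero hq0)]
      refine (Submodule.sub_mem_iff_left S ?_).mp h1
      refine S.sum_mem fun k _ => ?_
      split_ifs with hk
      · exact S.smul_mem _ (ih k hk)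
      · simp
  rw [entries, entries, Submodule.span_mul_span]
  refine Submodule.span_le.mpr ?_
  rintro _ ⟨_, ⟨i, a, rfl⟩, _, ⟨b, j, rfl⟩, rfl⟩
  by_cases hab : a = b
  · subst hab; exact h0 a i j
  · have h1 := h (b, i) (a, j)
    rwa [leg2_rHinv_leg2_apply hq0, if_neg hab, if_neg hab, one_smul, sub_zero] at h1

end Entries

/-! ### A reordering criterion for nilpotency -/

section Nilpotency

variable {K : Type*} [Field K] {A : Type*} [Ring A] [Algebra K A]

/-- If every product `x_a x_b` with `b ≤ a` can be rewritten with a smaller first factor, then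
all products of more than `m` of the `m` generators vanish. -/
theorem span_pow_eq_bot_of_reorder {m : ℕ} (x : Fin m → A)
    (h : ∀ a b, b ≤ a →
      x a * x b ∈ Submodule.span K (x '' Set.Iio a) * Submodule.span K (Set.range x)) :
    Submodule.span K (Set.range x) ^ (m + 1) = ⊥ := by
  set G := Submodule.span K (Set.range x) with hG
  set I : ℕ → Submodule K A := fun k => Submodule.span K (x '' {a | (a : ℕ) < k}) with hI
  -- Each additional factor lowers the bound on the first index by one. If the first index exceeds
  -- the new bound, the next factor can be taken with an index not above it, and reordering lowers
  -- the first one. At `n = m` no index is left.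
  have key : ∀ n, n ≤ m → G ^ (n + 1) ≤ I (m - n) * G ^ n := by
    intro n
    induction n with
    | zero =>
      intro _
      have : G ≤ I m := Submodule.span_mono (by rintro _ ⟨a, rfl⟩; exact ⟨a, a.2, rfl⟩)
      simpa using this
    | succ n ih =>
      intro hn
      have ih := ih (by omega)
      have step : ∀ a : Fin m, Submodule.span K {x a} * G ^ (n + 1) ≤
          I (m - (n + 1)) * G ^ (n + 1) := by
        intro a
        induction a using WellFoundedLT.induction with
        | ind a iha =>
          by_cases ha : (a : ℕ) < m - (n + 1)
          · exact mul_le_mul_left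
              (Submodule.span_mono (by rintro _ rfl; exact ⟨a, ha, rfl⟩)) _
          · have h1 : Submodule.span K {x a} * I (m - n) ≤
                Submodule.span K (x '' Set.Iio a) * G := by
              rw [hI, Submodule.span_mul_span, Submodule.span_le]
              rintro _ ⟨_, rfl, _, ⟨b, hb, rfl⟩, rfl⟩
              refine h a b (Fin.le_def.mpr ?_)
              simp only [Set.mem_ofPred_eq] at hb
              omega
            have h2 : Submodule.span K (x '' Set.Iio a) * G ^ (n + 1) ≤
                I (m - (n + 1)) * G ^ (n + 1) := by
              have : Submodule.span K (x '' Set.Iio a) =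
                  ⨆ b : Set.Iio a, Submodule.span K {x b} := by
                rw [← Submodule.span_iUnion]
                congr 1
                ext y
                simp [eq_comm]
              rw [this, Submodule.iSup_mul]
              exact iSup_le fun b => iha b b.2
            calc Submodule.span K {x a} * G ^ (n + 1)
                ≤ Submodule.span K {x a} * (I (m - n) * G ^ n) := mul_le_mul_right ih _
              _ = Submodule.span K {x a} * I (m - n) * G ^ n := (mul_assoc _ _ _).symm
              _ ≤ Submodule.span K (x '' Set.Iio a) * G * G ^ n := mul_le_mul_left h1 _
              _ = Submodule.span K (x '' Set.Iio a) * G ^ (n + 1) := by rw [mul_assoc, pow_succ']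
              _ ≤ _ := h2
      have hGs : G = ⨆ a, Submodule.span K {x a} := by
        rw [← Submodule.span_iUnion, hG]
        congr 1
        ext y
        simp [eq_comm]
      calc G ^ (n + 1 + 1) = G * G ^ (n + 1) := pow_succ' _ _
        _ = ⨆ a, Submodule.span K {x a} * G ^ (n + 1) := by
          nth_rewrite 1 [hGs]; rw [Submodule.iSup_mul]
        _ ≤ _ := iSup_le step
  have := key m le_rfl
  simpa [hI] using this

end Nilpotency

/-! ### Normal ordering of words in two spaces -/

section Ordering

variable {K : Type*} [Field K] {A : Type*} [Ring A] [Algebra K A]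

theorem pow_mul_le_mul_pow {G P : Submodule K A} (h : G * P ≤ P * G) (n : ℕ) :
    G ^ n * P ≤ P * G ^ n := by
  induction n with
  | zero => simp
  | succ n ih =>
    calc G ^ (n + 1) * P = G ^ n * (G * P) := by rw [pow_succ, mul_assoc]
      _ ≤ G ^ n * (P * G) := mul_le_mul_right h _
      _ = G ^ n * P * G := (mul_assoc _ _ _).symm
      _ ≤ P * G ^ n * G := mul_le_mul_left ih _
      _ = P * G ^ (n + 1) := by rw [pow_succ, mul_assoc]

theorem mul_pow_le_pow_mul {G P : Submodule K A} (h : P * G ≤ G * P) (n : ℕ) :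
    P * G ^ n ≤ G ^ n * P := by
  induction n with
  | zero => simp
  | succ n ih =>
    calc P * G ^ (n + 1) = P * G ^ n * G := by rw [pow_succ, mul_assoc]
      _ ≤ G ^ n * P * G := mul_le_mul_left ih _
      _ = G ^ n * (P * G) := mul_assoc _ _ _
      _ ≤ G ^ n * (G * P) := mul_le_mul_right h _
      _ = G ^ (n + 1) * P := by rw [pow_succ, mul_assoc]

theorem mul_pow_le {G H : Submodule K A} (h : H * G ≤ G * H ⊔ 1) (n : ℕ) :
    H * G ^ (n + 1) ≤ G ^ (n + 1) * H ⊔ G ^ n := by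
  induction n with
  | zero => simpa using h
  | succ n ih =>
    calc H * G ^ (n + 1 + 1) = H * G ^ (n + 1) * G := by rw [pow_succ _ (n + 1), mul_assoc]
      _ ≤ (G ^ (n + 1) * H ⊔ G ^ n) * G := mul_le_mul_left ih _
      _ = G ^ (n + 1) * (H * G) ⊔ G ^ (n + 1) := by
        rw [Submodule.sup_mul, mul_assoc, ← pow_succ]
      _ ≤ G ^ (n + 1) * (G * H ⊔ 1) ⊔ G ^ (n + 1) := sup_le_sup_right (mul_le_mul_right h _) _
      _ = G ^ (n + 1 + 1) * H ⊔ G ^ (n + 1) := by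
        rw [Submodule.mul_sup, mul_one, sup_assoc, sup_idem, ← mul_assoc, ← pow_succ]

/-- The span of the ordered monomials. -/
def orderedSpan (G H : Submodule K A) : Submodule K A := ⨆ n : ℕ, G ^ n * H ^ n

/-- A contraction removes one factor from `G` and one from `H`, so the exponents remain equal. -/
theorem mul_orderedSpan_le {G H : Submodule K A} (h : H * G ≤ G * H ⊔ 1) :
    G * H * orderedSpan G H ≤ orderedSpan G H := by
  unfold orderedSpan
  rw [Submodule.mul_iSup]
  refine iSup_le fun n => ?_
  have hn : ∀ n, G ^ n * H ^ n ≤ ⨆ n : ℕ, G ^ n * H ^ n := le_iSup fun n : ℕ => G ^ n * H ^ n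
  cases n with
  | zero => simpa using hn 1
  | succ n =>
    calc G * H * (G ^ (n + 1) * H ^ (n + 1)) = G * (H * G ^ (n + 1)) * H ^ (n + 1) := by
          simp only [mul_assoc]
      _ ≤ G * (G ^ (n + 1) * H ⊔ G ^ n) * H ^ (n + 1) :=
          mul_le_mul_left (mul_le_mul_right (mul_pow_le h n) _) _
      _ = G ^ (n + 2) * H ^ (n + 2) ⊔ G ^ (n + 1) * H ^ (n + 1) := by
          rw [Submodule.mul_sup, Submodule.sup_mul, ← pow_succ', ← mul_assoc, ← pow_succ',
            mul_assoc _ H, ← pow_succ']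
      _ ≤ _ := sup_le (hn _) (hn _)

/-- Nilpotency of `G` alone bounds the common exponent. -/
theorem fg_orderedSpan {G H : Submodule K A} (hG : G.FG) (hH : H.FG) {m : ℕ}
    (hm : G ^ (m + 1) = ⊥) : (orderedSpan G H).FG := by
  have : orderedSpan G H = ⨆ n ∈ Finset.range (m + 1), G ^ n * H ^ n := by
    refine le_antisymm (iSup_le fun n => ?_) (iSup₂_le fun n _ => le_iSup_of_le n le_rfl)
    by_cases hn : n < m + 1
    · exact le_iSup₂_of_le n (Finset.mem_range.mpr hn) le_rfl
    · obtain ⟨k, rfl⟩ := Nat.exists_eq_add_of_le (not_lt.mp hn)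
      rw [pow_add, hm]
      simp
  rw [this]
  exact Submodule.fg_biSup _ _ fun n _ => (hG.pow n).mul (hH.pow n)

theorem entries_fg {m n : Type*} [Finite m] [Finite n] (X : Matrix m n A) : (entries K X).FG := by
  refine Submodule.fg_span ?_
  have : {x | ∃ i j, x = X i j} = Set.range fun p : m × n => X p.1 p.2 := by
    ext x; simp [eq_comm]
  rw [this]
  exact Set.finite_range _

end Ordering

/-! ### Nilpotency of `ω` and inversion of `1 + λωJ` -/

namespace BrstRelations

variable {K : Type*} [Field K] {A : Type*} [Ring A] [Algebra K A] {N : ℕ}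
variable {q : K} {T T' L ω J V : Matrix (Fin N) (Fin N) A}
variable (h : BrstRelations q T T' L ω J) (hq0 : q ≠ 0)
include h hq0

/-- Since `R̂` commutes with `T₁T₂`, the reflection relation for `ω` becomes one with `R̂` only at
the ends. Entry by entry it is a `q`-antisymmetry, which orders monomials directly. -/
theorem exterior_rel : rH A N q * (leg1 (T * ω) * leg2 (T * ω)) =
    -(leg1 (T * ω) * leg2 (T * ω) * rHinv A N q) := by
  have hrs := rH_mul_rHinv (A := A) (N := N) hq0
  have e : leg1 (T * ω) * leg2 (T * ω) =
      leg1 T * leg2 T * (rHinv A N q * leg2 ω * rHinv A N q * leg2 ω) := by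
    rw [leg1_mul, leg2_mul, mul_assoc, ← mul_assoc (leg1 ω), h.om_T]
    simp only [mul_assoc]
  have e2 : rHinv A N q * leg2 ω * rHinv A N q * leg2 ω * rHinv A N q =
      -(leg2 ω * rHinv A N q * leg2 ω) := by
    rw [← neg_eq_iff_eq_neg, ← neg_mul, ← h.om_om, mul_assoc, hrs, mul_one]
  have e3 : ∀ x, rH A N q * (leg1 T * leg2 T * x) = leg1 T * leg2 T * (rH A N q * x) := fun x => by
    simpa only [mul_assoc] using congrArg (· * x) h.T_T
  rw [e, e3, mul_assoc (leg1 T * leg2 T) _ (rHinv A N q), e2]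
  simp only [mul_assoc, mul_tail hrs, mul_neg, neg_neg]

theorem exterior_rel_apply (i1 i2 j1 j2 : Fin N) :
    (if i1 = i2 then q else 1) • ((T * ω) i2 j1 * (T * ω) i1 j2) +
      (if i1 < i2 then lam q else 0) • ((T * ω) i1 j1 * (T * ω) i2 j2) =
    -((if j1 = j2 then q⁻¹ else 1) • ((T * ω) i1 j2 * (T * ω) i2 j1) -
      (if j2 < j1 then lam q else 0) • ((T * ω) i1 j1 * (T * ω) i2 j2)) := by
  have hZ : ∀ a b c d : Fin N, (leg1 (T * ω) * leg2 (T * ω)) (a, b) (c, d) =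
      (T * ω) a c * (T * ω) b d := by
    intro a b c d
    rw [leg1_mul_apply, Finset.sum_eq_single c]
    · simp [leg2]
    · intro k _ hk; simp [leg2, hk]
    · simp
  have e := congrFun (congrFun (h.exterior_rel hq0) (i1, i2)) (j1, j2)
  rw [rH_mul_apply, Matrix.neg_apply, mul_rHinv_apply hq0] at e
  simpa only [hZ] using e

/-- For different rows the relation rewrites the product with a first factor in the smaller row. In
one row the coefficient is `q - λ = q⁻¹`. For equal factors the relation is `(q + q⁻¹)x² = 0`, and
`q⁴ ≠ 1` makes the square vanish. -/
theorem exterior_reorder (hq : ∀ n : ℕ, 0 < n → q ^ n ≠ 1) (x : Fin N ×ₗ Fin N → A)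
    (hx : ∀ a, x a = (T * ω) (ofLex a).1 (ofLex a).2) (a b : Fin N ×ₗ Fin N) (hab : b ≤ a) :
    x a * x b ∈ Submodule.span K (x '' Set.Iio a) * Submodule.span K (Set.range x) := by
  have hmem : ∀ c d, c < a → x c * x d ∈
      Submodule.span K (x '' Set.Iio a) * Submodule.span K (Set.range x) := fun c d hc =>
    Submodule.mul_mem_mul (Submodule.subset_span ⟨c, hc, rfl⟩) (Submodule.subset_span ⟨d, rfl⟩)
  have hx' : ∀ i j, (T * ω) i j = x (toLex (i, j)) := fun i j => by rw [hx]; rfl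
  obtain ⟨⟨i, j⟩, rfl⟩ := toLex.surjective a
  obtain ⟨⟨k, l⟩, rfl⟩ := toLex.surjective b
  set S := Submodule.span K (x '' Set.Iio (toLex (i, j))) * Submodule.span K (Set.range x)
  have e := h.exterior_rel_apply hq0 k i j l
  rw [Prod.Lex.toLex_le_toLex] at hab
  simp only [hx'] at e
  rcases hab with hki | ⟨hki, hlj⟩
  · simp only at hki
    have hlt : ∀ m, toLex (k, m) < toLex (i, j) := fun m => by
      rw [Prod.Lex.toLex_lt_toLex]; exact Or.inl hki
    rw [if_neg hki.ne, one_smul, ← eq_sub_iff_add_eq] at e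
    rw [e]
    exact S.sub_mem (S.neg_mem (S.sub_mem (S.smul_mem _ (hmem _ _ (hlt _)))
      (S.smul_mem _ (hmem _ _ (hlt _))))) (S.smul_mem _ (hmem _ _ (hlt _)))
  · simp only at hki hlj
    subst hki
    rcases hlj.lt_or_eq with hlj | rfl
    · have hlt : toLex (k, l) < toLex (k, j) := by
        rw [Prod.Lex.toLex_lt_toLex]; exact Or.inr ⟨rfl, hlj⟩
      rw [if_pos rfl, if_neg (lt_irrefl _), if_neg hlj.ne', if_pos hlj, zero_smul, add_zero,
        one_smul, neg_sub, eq_sub_iff_add_eq, ← eq_sub_iff_add_eq', ← sub_smul] at e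
      rw [← S.smul_mem_iff (inv_ne_zero hq0)]
      have : q⁻¹ = -(lam q - q) := by simp [lam]
      rw [this, neg_smul, ← e]
      exact S.neg_mem (hmem _ _ hlt)
    · rw [if_pos rfl, if_neg (lt_irrefl _), if_pos rfl, if_neg (lt_irrefl _), zero_smul, add_zero,
        sub_zero, eq_neg_iff_add_eq_zero, ← add_smul, smul_eq_zero] at e
      rcases e with e | e
      · exfalso
        have : q ^ 2 + 1 = 0 := by
          have := congrArg (q * ·) e
          simp only [mul_add, mul_inv_cancel₀ hq0, mul_zero] at this
          rw [sq]; exact this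
        exact hq 4 (by norm_num) (by linear_combination (q ^ 2 - 1) * this)
      · rw [e]; exact S.zero_mem

theorem pow_entries_exterior (hq : ∀ n : ℕ, 0 < n → q ^ n ≠ 1) :
    entries K (T * ω) ^ (N ^ 2 + 1) = ⊥ := by
  let e : Fin (N ^ 2) ≃o (Fin N ×ₗ Fin N) := Fintype.orderIsoFinOfCardEq _ (by
    rw [Fintype.card_lex]; simp [sq])
  let x : Fin N ×ₗ Fin N → A := fun a => (T * ω) (ofLex a).1 (ofLex a).2
  have hr : Set.range (x ∘ e) = Set.range x := e.surjective.range_comp x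
  have := span_pow_eq_bot_of_reorder (K := K) (x ∘ e) fun a b hab => by
    have h1 := h.exterior_reorder hq0 hq x (fun _ => rfl) (e a) (e b) (e.monotone hab)
    rw [hr, Set.image_comp, e.image_Iio]
    exact h1
  rw [hr] at this
  rw [← this, entries]
  congr 2
  ext y
  constructor
  · rintro ⟨i, j, rfl⟩
    exact ⟨toLex (i, j), rfl⟩
  · rintro ⟨a, rfl⟩
    exact ⟨_, _, rfl⟩

/-- The `ω`-`T` relation becomes `R̂(Tω)₁T₂R̂ = T₁(Tω)₂`. Inverting both `T` gives `(Tω)₂R̂⁻¹T'₂ =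
T'₁R̂(Tω)₁`, to which skew invertibility applies. -/
theorem exterior_T' : entries K (T * ω) * entries K T' ≤ entries K T' * entries K (T * ω) := by
  refine mul_entries_le_of_rHinv hq0 ?_
  have hrs := rH_mul_rHinv (A := A) (N := N) hq0
  have e : rH A N q * leg1 (T * ω) * leg2 T * rH A N q = leg1 T * leg2 (T * ω) := by
    rw [leg1_mul, leg2_mul, mul_assoc _ _ (leg2 T), mul_assoc (leg1 T), h.om_T]
    simp only [← mul_assoc]
    rw [h.T_T]
    simp only [mul_assoc, mul_tail hrs, rHinv_mul_rH hq0, mul_one]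
  have h1 := leg1_eq_one h.T'_T
  have h2 := leg2_eq_one h.T_T'
  have e2 := congrArg (fun z => leg1 T' * z * rHinv A N q * leg2 T') e
  simp only [mul_assoc, mul_tail h1, mul_tail hrs, h2, mul_one] at e2
  rw [← e2]
  exact (entriesIn_entries _).leg1.mul (entriesIn_entries _).leg1.rH_mul

theorem pow_entries_om (hq : ∀ n : ℕ, 0 < n → q ^ n ≠ 1) : entries K ω ^ (N ^ 2 + 1) = ⊥ := by
  have h1 : entries K ω ≤ entries K T' * entries K (T * ω) := by
    refine entries_le ?_
    have : ω = T' * (T * ω) := by rw [← mul_assoc, h.T'_T, one_mul]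
    nth_rewrite 2 [this]
    exact (entriesIn_entries _).mul (entriesIn_entries _)
  have h2 : ∀ n : ℕ, entries K ω ^ n ≤ entries K T' ^ n * entries K (T * ω) ^ n := by
    intro n
    induction n with
    | zero => simp
    | succ n ih =>
      calc entries K ω ^ (n + 1) ≤ entries K T' ^ n * entries K (T * ω) ^ n *
            (entries K T' * entries K (T * ω)) := by
            rw [pow_succ]; exact mul_le_mul' ih h1
        _ = entries K T' ^ n * (entries K (T * ω) ^ n * entries K T') * entries K (T * ω) := by
            simp only [mul_assoc]
        _ ≤ entries K T' ^ n * (entries K T' * entries K (T * ω) ^ n) * entries K (T * ω) :=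
            mul_le_mul_left (mul_le_mul_right (pow_mul_le_mul_pow (h.exterior_T' hq0) n) _) _
        _ = _ := by simp only [pow_succ, mul_assoc]
  have h3 := h2 (N ^ 2 + 1)
  rw [h.pow_entries_exterior hq0 hq, Submodule.mul_bot] at h3
  exact le_bot_iff.mp h3

theorem J_om_le : entries K J * entries K ω ≤ entries K ω * entries K J ⊔ 1 := by
  have hrs := rH_mul_rHinv (A := A) (N := N) hq0
  have hsr := rHinv_mul_rH (A := A) (N := N) hq0
  refine mul_entries_le_of_rH hq0 ?_
  have e : leg2 J * (rH A N q * leg2 ω) =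
      -1 - rHinv A N q * (leg2 ω * (rH A N q * (leg2 J * rH A N q))) := by
    have e := congrArg (rHinv A N q * ·) h.om_J
    simp only [mul_add, mul_assoc, mul_neg, hsr, mul_tail hsr] at e
    rw [← e]; abel
  rw [e]
  refine .sub (EntriesIn.one.neg.mono le_sup_right) (EntriesIn.mono ?_ le_sup_left)
  exact ((entriesIn_entries _).leg2.mul (entriesIn_entries _).leg2.mul_rH.rH_mul).rHinv_mul hq0

theorem L_om_le : entries K L * entries K ω ≤ entries K ω * entries K L := by
  have hsr := rHinv_mul_rH (A := A) (N := N) hq0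
  refine mul_entries_le_of_rH hq0 ?_
  have e : leg2 L * (rH A N q * leg2 ω) =
      rHinv A N q * (leg2 ω * (rH A N q * (leg2 L * rH A N q))) := by
    have e := congrArg (rHinv A N q * ·) h.om_L
    simp only [mul_assoc, mul_tail hsr] at e
    exact e.symm
  rw [e]
  exact ((entriesIn_entries _).leg2.mul (entriesIn_entries _).leg2.mul_rH.rH_mul).rHinv_mul hq0

theorem entriesIn_pow (n : ℕ) :
    EntriesIn (orderedSpan (entries K ω) (entries K J)) ((ω * J) ^ n) := by
  induction n with
  | zero =>
    rw [pow_zero]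
    exact EntriesIn.one.mono (le_iSup_of_le 0 (by simp))
  | succ n ih =>
    rw [pow_succ']
    exact (((entriesIn_entries ω).mul (entriesIn_entries J)).mul ih).mono
      (mul_orderedSpan_le (h.J_om_le hq0))

/-- If `WV = 1 + E`, moving `W` past `ω` and tracing gives `Y` with `WY = ω + F`, where `F` has one
more `ω` on the left than `E`. Then `W(1 - λYJ) = 1 - λFJ`, so the error improves by one order. -/
theorem exists_right_inverse_mod (n : ℕ) : ∃ V : Matrix (Fin N) (Fin N) A,
    EntriesIn (entries K ω ^ n * ⊤) ((1 + lam q • (ω * J)) * V - 1) := by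
  have hrs := rH_mul_rHinv (A := A) (N := N) hq0
  have hsr := rHinv_mul_rH (A := A) (N := N) hq0
  induction n with
  | zero => exact ⟨0, fun i j => by simp⟩
  | succ n ih =>
    obtain ⟨V, hV⟩ := ih
    set W := 1 + lam q • (ω * J) with hW
    set E := W * V - 1 with hE
    set Y := qTrace1 q (rH A N q * leg2 ω * rHinv A N q * leg2 V * rH A N q) with hY
    set F := qTrace1 q (rHinv A N q * leg2 ω * rHinv A N q * leg2 E * rH A N q) with hF
    have hWY : W * Y = ω + F := by
      have hWo := h.W_om hq0
      rw [← leg2_W, ← hW] at hWo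
      have hWV : leg2 W * leg2 V = leg2 E + 1 := by
        rw [← leg2_mul, ← leg2_one, ← leg2_add, hE, sub_add_cancel]
      have e : leg2 W * (rH A N q * leg2 ω * rHinv A N q * leg2 V * rH A N q) =
          rHinv A N q * leg2 ω * rHinv A N q * (leg2 W * leg2 V) * rH A N q := by
        calc _ = (leg2 W * rH A N q * leg2 ω) * rHinv A N q * leg2 V * rH A N q := by
              simp only [mul_assoc]
          _ = _ := by rw [hWo]; simp only [mul_assoc, mul_tail hrs]
      rw [hY, ← qTrace1_leg2_mul, e, hWV, mul_add, mul_one, add_mul, qTrace1_add, ← hF,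
        mul_assoc _ (rHinv A N q) (rH A N q), hsr, mul_one, qTrace1_mul_leg2, qTrace1_rHinv hq0,
        one_mul, add_comm]
    have hFmem : EntriesIn (entries K ω ^ (n + 1) * ⊤) F := by
      rw [pow_succ', mul_assoc]
      refine EntriesIn.qTrace1 ?_
      simp only [mul_assoc]
      exact ((entriesIn_entries _).leg2.mul (hV.leg2.mul_rH.rHinv_mul hq0)).rHinv_mul hq0
    refine ⟨1 - lam q • (Y * J), ?_⟩
    have e : W * (1 - lam q • (Y * J)) - 1 = -(lam q • (F * J)) := by
      rw [mul_sub, mul_one, mul_smul_comm, ← mul_assoc, hWY, hW, add_mul, smul_add]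
      abel
    rw [e]
    refine (EntriesIn.smul _ ((hFmem.mul (S' := ⊤) fun _ _ => trivial).mono ?_)).neg
    rw [mul_assoc]
    exact mul_le_mul_right le_top _

/-- At order `N² + 1` the error vanishes and `W` has a right inverse `X`. Normal ordering makes
`K[ωJ]` finite-dimensional, and right multiplication by `W` is injective on it because `X` cancels
`W`. It is therefore surjective, which gives a left inverse in `K[ωJ]`; this equals `X`. -/
theorem exists_inverse (hq : ∀ n : ℕ, 0 < n → q ^ n ≠ 1) :
    ∃ V ∈ Algebra.adjoin K {ω * J},
      (1 + lam q • (ω * J)) * V = 1 ∧ V * (1 + lam q • (ω * J)) = 1 := by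
  obtain ⟨X, hX⟩ := h.exists_right_inverse_mod hq0 (N ^ 2 + 1)
  rw [h.pow_entries_om hq0 hq, Submodule.bot_mul] at hX
  have hWX : (1 + lam q • (ω * J)) * X = 1 := by
    rw [← sub_eq_zero]; ext i j; simpa using hX i j
  set B := Algebra.adjoin K {ω * J} with hB
  set S := orderedSpan (entries K ω) (entries K J) with hS
  have hSfg : S.FG := fg_orderedSpan (entries_fg _) (entries_fg _) (h.pow_entries_om hq0 hq)
  have hBS : ∀ Y ∈ B, EntriesIn S Y := by
    intro Y hY
    rw [hB, Algebra.adjoin_singleton_eq_range_aeval] at hY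
    obtain ⟨p, rfl⟩ := hY
    change EntriesIn _ (Polynomial.aeval (ω * J) p)
    rw [Polynomial.aeval_eq_sum_range]
    intro i j
    rw [Matrix.sum_apply]
    exact S.sum_mem fun k _ => S.smul_mem _ (h.entriesIn_pow hq0 k i j)
  have : Module.Finite K S := Module.Finite.iff_fg.mpr hSfg
  let toS : B →ₗ[K] (Fin N → Fin N → S) :=
    { toFun := fun Y i j => ⟨Y.1 i j, hBS Y.1 Y.2 i j⟩
      map_add' := fun _ _ => rfl
      map_smul' := fun _ _ => rfl }
  have htoS : Function.Injective toS := by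
    intro Y Z hYZ
    ext i j
    exact congrArg Subtype.val (congrFun (congrFun hYZ i) j)
  have : Module.Finite K B := Module.Finite.of_injective toS htoS
  have hWB : 1 + lam q • (ω * J) ∈ B :=
    B.add_mem B.one_mem (B.smul_mem (Algebra.self_mem_adjoin_singleton K _) _)
  let mulW : B →ₗ[K] B := LinearMap.mulRight K (⟨_, hWB⟩ : B)
  have hinj : Function.Injective mulW := by
    rw [injective_iff_map_eq_zero]
    intro Y hY
    have hY' : Y.1 * (1 + lam q • (ω * J)) = 0 := congrArg Subtype.val hY
    have := congrArg (· * X) hY'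
    simp only [mul_assoc, hWX, mul_one, zero_mul] at this
    exact Subtype.ext this
  obtain ⟨V, hV⟩ := (LinearMap.injective_iff_surjective.mp hinj) 1
  have hV' : V.1 * (1 + lam q • (ω * J)) = 1 := congrArg Subtype.val hV
  refine ⟨V.1, V.2, ?_, hV'⟩
  have : V.1 = X := by
    calc V.1 = V.1 * ((1 + lam q • (ω * J)) * X) := by rw [hWX, mul_one]
      _ = X := by rw [← mul_assoc, hV', one_mul]
  rw [this, hWX]

theorem qTrace_theta_mem (hq : ∀ n : ℕ, 0 < n → q ^ n ≠ 1)
    (hV : V ∈ Algebra.adjoin K {ω * J}) : qTrace q (ω * L * V) ∈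
      ⨆ r ∈ Finset.range (N ^ 2), entries K ω ^ (r + 1) * entries K L * entries K J ^ r := by
  have hVS : EntriesIn (orderedSpan (entries K ω) (entries K J)) V := by
    rw [Algebra.adjoin_singleton_eq_range_aeval] at hV
    obtain ⟨p, rfl⟩ := hV
    change EntriesIn _ (Polynomial.aeval (ω * J) p)
    rw [Polynomial.aeval_eq_sum_range]
    intro i j
    rw [Matrix.sum_apply]
    exact Submodule.sum_mem _ fun k _ => Submodule.smul_mem _ _ (h.entriesIn_pow hq0 k i j)
  refine EntriesIn.qTrace_mem ?_
  refine (((entriesIn_entries ω).mul (entriesIn_entries L)).mul hVS).mono ?_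
  rw [orderedSpan, Submodule.mul_iSup]
  refine iSup_le fun n => ?_
  have e : entries K ω * entries K L * (entries K ω ^ n * entries K J ^ n) ≤
      entries K ω ^ (n + 1) * entries K L * entries K J ^ n := by
    calc _ = entries K ω * (entries K L * entries K ω ^ n) * entries K J ^ n := by
          simp only [mul_assoc]
      _ ≤ entries K ω * (entries K ω ^ n * entries K L) * entries K J ^ n :=
          mul_le_mul_left (mul_le_mul_right (mul_pow_le_pow_mul (h.L_om_le hq0) n) _) _
      _ = _ := by rw [pow_succ']; simp only [mul_assoc]
  refine e.trans ?_
  by_cases hn : n < N ^ 2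
  · exact le_iSup₂_of_le n (Finset.mem_range.mpr hn) le_rfl
  -- The leading `ω` raises the exponent to `n + 1`, so all terms with `n ≥ N²` vanish.
  · obtain ⟨k, rfl⟩ := Nat.exists_eq_add_of_le (not_lt.mp hn)
    rw [show N ^ 2 + k + 1 = N ^ 2 + 1 + k by omega, pow_add (entries K ω),
      h.pow_entries_om hq0 hq]
    simp

end BrstRelations

/-! ### Passing from the presentation to matrix relations -/

section Presentation

variable {K : Type*} [Field K] {A B : Type*} [Ring A] [Algebra K A] [Ring B] [Algebra K B] {N : ℕ}
variable (f : A →ₐ[K] B)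

theorem map_mul_algHom {l m n : Type*} [Fintype m] (X : Matrix l m A) (Y : Matrix m n A) :
    (X * Y).map f = X.map f * Y.map f := by
  ext i j; simp [Matrix.mul_apply]

theorem map_add_algHom {m n : Type*} (X Y : Matrix m n A) : (X + Y).map f = X.map f + Y.map f := by
  ext i j; simp

theorem map_neg_algHom {m n : Type*} (X : Matrix m n A) : (-X).map f = -X.map f := by
  ext i j; simp

theorem map_one_algHom {m : Type*} [DecidableEq m] : (1 : Matrix m m A).map f = 1 := by
  ext i j; simp [Matrix.one_apply, apply_ite f]

theorem map_leg1 (X : Matrix (Fin N) (Fin N) A) : (leg1 X).map f = leg1 (X.map f) := by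
  ext i j; simp [leg1, Matrix.one_apply, apply_ite f]

theorem map_leg2 (X : Matrix (Fin N) (Fin N) A) : (leg2 X).map f = leg2 (X.map f) := by
  ext i j; simp [leg2, Matrix.one_apply, apply_ite f]

theorem map_rH (q : K) : (rH A N q).map f = rH B N q := by
  ext i j; simp [rH]

theorem map_rHinv (q : K) : (rHinv A N q).map f = rHinv B N q := by
  ext i j; simp [rHinv]

theorem map_qTrace (q : K) (X : Matrix (Fin N) (Fin N) A) :
    f (qTrace q X) = qTrace q (X.map f) := by
  simp [qTrace_eq]

/-- Each relation is homogeneous modulo `2` in `ω` and `J` together; in the inhomogeneous one both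
sides are even. This is why a parity automorphism exists. -/
theorem BrstRelations.neg {q : K} {T T' L ω J : Matrix (Fin N) (Fin N) A}
    (h : BrstRelations q T T' L ω J) : BrstRelations q T T' L (-ω) (-J) where
  T_T' := h.T_T'
  T'_T := h.T'_T
  T_T := h.T_T
  om_om := by simpa only [leg2_neg, mul_neg, neg_mul, neg_neg] using h.om_om
  om_L := by simp only [leg2_neg, mul_neg, neg_mul, h.om_L]
  om_J := by simpa only [leg2_neg, mul_neg, neg_mul, neg_neg] using h.om_J
  L_L := h.L_L
  J_L := by simp only [leg2_neg, mul_neg, neg_mul, h.J_L]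
  J_J := by simpa only [leg2_neg, mul_neg, neg_mul, neg_neg] using h.J_J
  om_T := by simp only [leg1_neg, leg2_neg, mul_neg, neg_mul, h.om_T]
  J_T := by simp only [leg1_neg, leg2_neg, mul_neg, neg_mul, h.J_T]
  L_T := h.L_T

variable (N) (q : K)

theorem map_eq_of_rel {m n : Type*} {X Y : Matrix m n (FreeAlgebra K (Gen N))}
    (h : ∀ i j, Rel N q (X i j) (Y i j)) :
    X.map (RingQuot.mkAlgHom K (Rel N q)) = Y.map (RingQuot.mkAlgHom K (Rel N q)) := by
  ext i j
  exact RingQuot.mkAlgHom_rel K (h i j)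

theorem map_freeL : (freeL K N).map (RingQuot.mkAlgHom K (Rel N q)) = matL N q := by
  rw [freeL, map_mul_algHom]; rfl

theorem brstRelations :
    BrstRelations q (matT N q) (matTinv N q) (matL N q) (matOm N q) (matJ N q) where
  T_T' := by
    have := map_eq_of_rel N q Rel.T_Tinv
    rwa [map_mul_algHom, map_one_algHom] at this
  T'_T := by
    have := map_eq_of_rel N q Rel.Tinv_T
    rwa [map_mul_algHom, map_one_algHom] at this
  T_T := by
    have := map_eq_of_rel N q Rel.T_T
    simp only [map_mul_algHom, map_leg1, map_leg2, map_rH] at this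
    exact this
  om_om := by
    have := map_eq_of_rel N q Rel.om_om
    simp only [map_mul_algHom, map_neg_algHom, map_leg2, map_rH, map_rHinv] at this
    exact this
  om_L := by
    have := map_eq_of_rel N q Rel.om_L
    simp only [map_mul_algHom, map_leg2, map_rH, map_freeL] at this
    exact this
  om_J := by
    have := map_eq_of_rel N q Rel.om_J
    simp only [map_mul_algHom, map_add_algHom, map_neg_algHom, map_leg2, map_rH] at this
    exact this
  L_L := by
    have := map_eq_of_rel N q Rel.L_L
    simp only [map_mul_algHom, map_leg2, map_rH, map_freeL] at this
    exact this
  J_L := by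
    have := map_eq_of_rel N q Rel.J_L
    simp only [map_mul_algHom, map_leg2, map_rH, map_freeL] at this
    exact this
  J_J := by
    have := map_eq_of_rel N q Rel.J_J
    simp only [map_mul_algHom, map_neg_algHom, map_leg2, map_rH, map_rHinv] at this
    exact this
  om_T := by
    have := map_eq_of_rel N q Rel.om_T
    simp only [map_mul_algHom, map_leg1, map_leg2, map_rHinv] at this
    exact this
  J_T := by
    have := map_eq_of_rel N q Rel.J_T
    simp only [map_mul_algHom, map_leg1, map_leg2, map_rH] at this
    exact this
  L_T := by
    have := map_eq_of_rel N q Rel.L_T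
    simp only [map_mul_algHom, map_leg1, map_leg2, map_rH, map_freeL] at this
    exact this

end Presentation

/-! ### The parity automorphism -/

section Parity

variable {K : Type*} [Field K] (N : ℕ) (q : K)

/-- The images of the generators under the parity automorphism. -/
noncomputable def parityGen : Gen N → DiffAlg N q
  | .T i j => matT N q i j
  | .Tinv i j => matTinv N q i j
  | .Lp i j => matOf N q Gen.Lp i j
  | .Lm i j => matOf N q Gen.Lm i j
  | .SLp i j => matOf N q Gen.SLp i j
  | .SLm i j => matOf N q Gen.SLm i j
  | .om i j => -matOm N q i j
  | .J i j => -matJ N q i j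

/-- The parity automorphism on the free algebra. -/
noncomputable def freeParity : FreeAlgebra K (Gen N) →ₐ[K] DiffAlg N q :=
  FreeAlgebra.lift K (parityGen N q)

theorem map_freeParity_even {c : Fin N → Fin N → Gen N}
    (h : ∀ i j, parityGen N q (c i j) = matOf N q c i j) :
    (genMat K N c).map (freeParity N q) = matOf N q c := by
  ext i j
  simp [genMat, freeParity, h]

theorem map_freeParity_odd {c : Fin N → Fin N → Gen N}
    (h : ∀ i j, parityGen N q (c i j) = -matOf N q c i j) :
    (genMat K N c).map (freeParity N q) = -matOf N q c := by
  ext i j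
  simp [genMat, freeParity, h]

theorem map_freeParity_freeL : (freeL K N).map (freeParity N q) = matL N q := by
  rw [freeL, map_mul_algHom, map_freeParity_even N q fun _ _ => rfl,
    map_freeParity_even N q fun _ _ => rfl]
  rfl

theorem freeParity_rel ⦃x y : FreeAlgebra K (Gen N)⦄ (h : Rel N q x y) :
    freeParity N q x = freeParity N q y := by
  have hb := brstRelations N q
  have hb' := hb.neg
  have hT : (genMat K N Gen.T).map (freeParity N q) = matT N q :=
    map_freeParity_even N q fun _ _ => rfl
  have hT' : (genMat K N Gen.Tinv).map (freeParity N q) = matTinv N q :=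
    map_freeParity_even N q fun _ _ => rfl
  have hLp : (genMat K N Gen.Lp).map (freeParity N q) = matOf N q Gen.Lp :=
    map_freeParity_even N q fun _ _ => rfl
  have hLm : (genMat K N Gen.Lm).map (freeParity N q) = matOf N q Gen.Lm :=
    map_freeParity_even N q fun _ _ => rfl
  have hSLp : (genMat K N Gen.SLp).map (freeParity N q) = matOf N q Gen.SLp :=
    map_freeParity_even N q fun _ _ => rfl
  have hSLm : (genMat K N Gen.SLm).map (freeParity N q) = matOf N q Gen.SLm :=
    map_freeParity_even N q fun _ _ => rfl
  have hom : (genMat K N Gen.om).map (freeParity N q) = -matOm N q :=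
    map_freeParity_odd N q fun _ _ => rfl
  have hJ : (genMat K N Gen.J).map (freeParity N q) = -matJ N q :=
    map_freeParity_odd N q fun _ _ => rfl
  have hL := map_freeParity_freeL (K := K) N q
  have red : ∀ {m n : Type} {X Y : Matrix m n (FreeAlgebra K (Gen N))} (i : m) (j : n),
      X.map (freeParity N q) = Y.map (freeParity N q) →
      freeParity N q (X i j) = freeParity N q (Y i j) := fun i j e =>
    congrFun (congrFun e i) j
  -- For relations among `L^±` and their antipodes the parity map agrees with the quotient map, so
  -- the relation itself suffices.
  have red' : ∀ {m n : Type} {X Y : Matrix m n (FreeAlgebra K (Gen N))} (i : m) (j : n),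
      X.map (RingQuot.mkAlgHom K (Rel N q)) = X.map (freeParity N q) →
      Y.map (RingQuot.mkAlgHom K (Rel N q)) = Y.map (freeParity N q) →
      Rel N q (X i j) (Y i j) →
      freeParity N q (X i j) = freeParity N q (Y i j) := fun {m n X Y} i j e1 e2 h => by
    have h1 := congrFun (congrFun e1 i) j
    have h2 := congrFun (congrFun e2 i) j
    simp only [Matrix.map_apply] at h1 h2
    rw [← h1, ← h2]
    exact RingQuot.mkAlgHom_rel K h
  have hgen : ∀ c, (genMat K N c).map (RingQuot.mkAlgHom K (Rel N q)) = matOf N q c :=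
    fun c => rfl
  have hLp' : ∀ i j, freeParity N q (genMat K N Gen.Lp i j) =
      RingQuot.mkAlgHom K (Rel N q) (genMat K N Gen.Lp i j) := fun i j =>
    congrFun (congrFun hLp i) j
  have hLm' : ∀ i j, freeParity N q (genMat K N Gen.Lm i j) =
      RingQuot.mkAlgHom K (Rel N q) (genMat K N Gen.Lm i j) := fun i j =>
    congrFun (congrFun hLm i) j
  cases h with
  | T_Tinv i j =>
    refine red i j ?_
    rw [map_mul_algHom, map_one_algHom, hT, hT', hb.T_T']
  | Tinv_T i j =>
    refine red i j ?_
    rw [map_mul_algHom, map_one_algHom, hT, hT', hb.T'_T]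
  | T_T i j =>
    refine red i j ?_
    simp only [map_mul_algHom, map_leg1, map_leg2, map_rH, hT, hb.T_T]
  | Lp_SLp i j =>
    exact red' i j (by simp only [map_mul_algHom, hgen, hLp, hSLp]) (by simp only [map_one_algHom])
      (Rel.Lp_SLp i j)
  | SLp_Lp i j =>
    exact red' i j (by simp only [map_mul_algHom, hgen, hLp, hSLp]) (by simp only [map_one_algHom])
      (Rel.SLp_Lp i j)
  | Lm_SLm i j =>
    exact red' i j (by simp only [map_mul_algHom, hgen, hLm, hSLm]) (by simp only [map_one_algHom])
      (Rel.Lm_SLm i j)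
  | SLm_Lm i j =>
    exact red' i j (by simp only [map_mul_algHom, hgen, hLm, hSLm]) (by simp only [map_one_algHom])
      (Rel.SLm_Lm i j)
  | Lp_upper i j h =>
    rw [hLp', map_zero, RingQuot.mkAlgHom_rel K (Rel.Lp_upper i j h), map_zero]
  | Lm_lower i j h =>
    rw [hLm', map_zero, RingQuot.mkAlgHom_rel K (Rel.Lm_lower i j h), map_zero]
  | L_diag i =>
    rw [map_mul, hLp', hLm', map_one, ← map_mul, RingQuot.mkAlgHom_rel K (Rel.L_diag i), map_one]
  | Lp_Lp i j =>
    exact red' i j (by simp only [map_mul_algHom, map_leg1, map_leg2, map_rH, hgen, hLp])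
      (by simp only [map_mul_algHom, map_leg1, map_leg2, map_rH, hgen, hLp]) (Rel.Lp_Lp i j)
  | Lm_Lm i j =>
    exact red' i j (by simp only [map_mul_algHom, map_leg1, map_leg2, map_rH, hgen, hLm])
      (by simp only [map_mul_algHom, map_leg1, map_leg2, map_rH, hgen, hLm]) (Rel.Lm_Lm i j)
  | Lp_Lm i j =>
    exact red' i j (by simp only [map_mul_algHom, map_leg1, map_leg2, map_rH, hgen, hLm, hLp])
      (by simp only [map_mul_algHom, map_leg1, map_leg2, map_rH, hgen, hLm, hLp]) (Rel.Lp_Lm i j)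
  | om_om i j =>
    refine red i j ?_
    simp only [map_mul_algHom, map_neg_algHom, map_leg2, map_rH, map_rHinv, hom]
    exact hb'.om_om
  | om_L i j =>
    refine red i j ?_
    simp only [map_mul_algHom, map_leg2, map_rH, hom, hL]
    exact hb'.om_L
  | om_J i j =>
    refine red i j ?_
    simp only [map_mul_algHom, map_add_algHom, map_neg_algHom, map_leg2, map_rH, hom, hJ]
    exact hb'.om_J
  | L_L i j =>
    refine red i j ?_
    simp only [map_mul_algHom, map_leg2, map_rH, hL]
    exact hb'.L_L
  | J_L i j =>
    refine red i j ?_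
    simp only [map_mul_algHom, map_leg2, map_rH, hJ, hL]
    exact hb'.J_L
  | J_J i j =>
    refine red i j ?_
    simp only [map_mul_algHom, map_neg_algHom, map_leg2, map_rH, map_rHinv, hJ]
    exact hb'.J_J
  | om_T i j =>
    refine red i j ?_
    simp only [map_mul_algHom, map_leg1, map_leg2, map_rHinv, hom, hT]
    exact hb'.om_T
  | J_T i j =>
    refine red i j ?_
    simp only [map_mul_algHom, map_leg1, map_leg2, map_rH, hJ, hT]
    exact hb'.J_T
  | L_T i j =>
    refine red i j ?_
    simp only [map_mul_algHom, map_leg1, map_leg2, map_rH, hL, hT]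
    exact hb'.L_T

/-- The parity automorphism of the differential algebra: `ω` and `J` are odd, the other generators
are even. -/
noncomputable def parity : DiffAlg N q →ₐ[K] DiffAlg N q :=
  RingQuot.liftAlgHom K ⟨freeParity N q, freeParity_rel N q⟩

theorem parity_mk (x : FreeAlgebra K (Gen N)) :
    parity N q (RingQuot.mkAlgHom K (Rel N q) x) = freeParity N q x :=
  RingQuot.liftAlgHom_mkAlgHom_apply _ _ _ _

theorem parity_T (i j : Fin N) : parity N q (matT N q i j) = matT N q i j :=
  (parity_mk N q _).trans (by simp [genMat, freeParity, parityGen])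

theorem parity_Tinv (i j : Fin N) : parity N q (matTinv N q i j) = matTinv N q i j :=
  (parity_mk N q _).trans (by simp [genMat, freeParity, parityGen])

theorem parity_om (i j : Fin N) : parity N q (matOm N q i j) = -matOm N q i j :=
  (parity_mk N q _).trans (by simp [genMat, freeParity, parityGen])

theorem parity_J (i j : Fin N) : parity N q (matJ N q i j) = -matJ N q i j :=
  (parity_mk N q _).trans (by simp [genMat, freeParity, parityGen])

theorem map_parity_L : (matL N q).map (parity N q) = matL N q := by
  rw [← map_freeL]
  ext i j
  simp only [Matrix.map_apply, parity_mk]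
  exact congrFun (congrFun ((map_freeParity_freeL N q).trans (map_freeL N q).symm) i) j

end Parity

/-! ### The operator `Q` and its commutation rules -/

section BrstOperator

variable {K : Type*} [Field K] {A : Type*} [Ring A] [Algebra K A] {N : ℕ}

/-- The operator `-λ⁻¹ Tr_q(ω) + λ⁻¹ Tr_q(ω L V)`, for an inverse `V` of `1 + λ ω J`. -/
noncomputable def brstOp (q : K) (ω L V : Matrix (Fin N) (Fin N) A) : A :=
  -((lam q)⁻¹ • qTrace q ω) + (lam q)⁻¹ • qTrace q (ω * L * V)

theorem diagonal_brstOp (q : K) (ω L V : Matrix (Fin N) (Fin N) A) :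
    (Matrix.diagonal fun _ => brstOp q ω L V : Matrix (Fin N) (Fin N) A) =
      (lam q)⁻¹ • ((Matrix.diagonal fun _ => qTrace q (ω * L * V)) -
        Matrix.diagonal fun _ => qTrace q ω) := by
  ext i j
  by_cases hij : i = j
  · subst hij
    simp only [brstOp, Matrix.diagonal_apply_eq, Matrix.smul_apply, Matrix.sub_apply, smul_sub]
    abel
  · simp [hij]

/-- The matrix `1 + λωJ` is even, and so is `V` by uniqueness of inverses; each trace then has
exactly one odd factor. -/
theorem brstOp_neg {q : K} {ω L J V : Matrix (Fin N) (Fin N) A} (f : A →ₐ[K] A)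
    (hω : ω.map f = -ω) (hL : L.map f = L) (hJ : J.map f = -J)
    (hWV : (1 + lam q • (ω * J)) * V = 1) (hVW : V * (1 + lam q • (ω * J)) = 1) :
    f (brstOp q ω L V) = -brstOp q ω L V := by
  have hV : V.map f = V := by
    have hW : (1 + lam q • (ω * J)).map f = 1 + lam q • (ω * J) := by
      have : (lam q • (ω * J)).map f = lam q • (ω * J).map f := by
        ext i j; exact map_smul f _ _
      rw [map_add_algHom, map_one_algHom, this, map_mul_algHom, hω, hJ, neg_mul_neg]
    have h1 : (1 + lam q • (ω * J)) * V.map f = 1 := by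
      rw [← hW, ← map_mul_algHom, hWV, map_one_algHom]
    calc V.map f = V * ((1 + lam q • (ω * J)) * V.map f) := by rw [← mul_assoc, hVW, one_mul]
      _ = V := by rw [h1, mul_one]
  rw [brstOp, map_add, map_neg, map_smul, map_smul, map_qTrace, map_qTrace, map_mul_algHom,
    map_mul_algHom, hω, hL, hV, neg_mul, neg_mul, qTrace_neg, qTrace_neg, smul_neg, smul_neg,
    neg_add]

/-- Iterating `V = 1 - λωJV` gives a geometric sum with exact remainder, so no convergence is
involved. -/
theorem brstOp_expansion {q : K} (hl : lam q ≠ 0) {ω L J V : Matrix (Fin N) (Fin N) A}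
    (hWV : (1 + lam q • (ω * J)) * V = 1) (m : ℕ) :
    brstOp q ω L V = qTrace q ((lam q)⁻¹ • (ω * (L - 1)) -
      ∑ k ∈ Finset.range m, (-lam q) ^ k • (ω * L * (ω * J) ^ (k + 1)) -
      (-lam q) ^ m • (ω * L * (ω * J) ^ (m + 1) * V)) := by
  have hV : V = 1 - lam q • (ω * J * V) := by
    rw [eq_sub_iff_add_eq, ← smul_mul_assoc, ← hWV, add_mul, one_mul]
  have key : ∀ m : ℕ, ∑ k ∈ Finset.range m, (-lam q) ^ k • (ω * L * (ω * J) ^ (k + 1)) +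
      (-lam q) ^ m • (ω * L * (ω * J) ^ (m + 1) * V) = (lam q)⁻¹ • (ω * L * (1 - V)) := by
    intro m
    induction m with
    | zero =>
      have h1 : 1 - V = lam q • (ω * J * V) := by nth_rewrite 1 [hV]; rw [sub_sub_cancel]
      rw [h1, mul_smul_comm, smul_smul, inv_mul_cancel₀ hl, one_smul]
      simp [mul_assoc]
    | succ m ih =>
      rw [← ih, Finset.sum_range_succ, add_assoc]
      congr 1
      nth_rewrite 2 [hV]
      rw [mul_sub, mul_one, mul_smul_comm, smul_sub, smul_smul, pow_succ (-lam q) m,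
        pow_succ (ω * J) (m + 1), mul_neg, neg_smul, sub_eq_add_neg]
      simp only [mul_assoc]
  rw [sub_sub, key, brstOp, ← qTrace_smul, ← qTrace_smul, ← qTrace_neg, ← qTrace_add, ← smul_sub,
    mul_sub, mul_sub, mul_one, mul_one, ← smul_neg, ← smul_add]
  congr 2
  abel

theorem entry_commutator {x : A} {Y Z : Matrix (Fin N) (Fin N) A}
    (h : (Matrix.diagonal fun _ => x) * Y = Y * (Matrix.diagonal fun _ => x) + Z) (i j : Fin N) :
    x * Y i j - Y i j * x = Z i j := by
  have := congrFun (congrFun h i) j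
  rw [Matrix.add_apply, diagonal_const_mul, mul_diagonal_const] at this
  rw [this, add_sub_cancel_left]

theorem entry_anticommutator {x : A} {Y Z : Matrix (Fin N) (Fin N) A}
    (h : (Matrix.diagonal fun _ => x) * Y + Y * (Matrix.diagonal fun _ => x) = Z) (i j : Fin N) :
    x * Y i j + Y i j * x = Z i j := by
  have := congrFun (congrFun h i) j
  rwa [Matrix.add_apply, diagonal_const_mul, mul_diagonal_const] at this

namespace BrstRelations

variable {q : K} {T T' L ω J V : Matrix (Fin N) (Fin N) A}
variable (h : BrstRelations q T T' L ω J) (hq0 : q ≠ 0)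
  (hWV : (1 + lam q • (ω * J)) * V = 1) (hVW : V * (1 + lam q • (ω * J)) = 1)
include h hq0 hWV hVW

/-- The squares of `Tr_q ω` and `Tr_q Θ` vanish. The cross terms cancel because tracing the
anticommutation of `Tr_q Θ` with `ω` makes the two traces anticommute. -/
theorem brstOp_mul_self [CharZero K] (hq : ∀ n : ℕ, 0 < n → q ^ n ≠ 1) :
    brstOp q ω L V * brstOp q ω L V = 0 := by
  have h1 : ReflectionOdd q ω := h.om_om
  have e1 := h1.sq_qTrace hq0 hq
  have e2 := (h.reflectionOdd_theta hq0 hWV hVW).sq_qTrace hq0 hq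
  have e3 := congrArg (qTrace q) (h.qTrace_theta_om hq0 hWV hVW)
  rw [qTrace_neg, qTrace_mul_left, qTrace_mul_right] at e3
  simp only [brstOp, add_mul, mul_add, neg_mul, mul_neg, smul_mul_assoc, mul_smul_comm, e1, e2, e3]
  simp

theorem brstOp_L : (Matrix.diagonal fun _ => brstOp q ω L V) * L =
    L * Matrix.diagonal fun _ => brstOp q ω L V := by
  rw [diagonal_brstOp, smul_mul_assoc, mul_smul_comm, sub_mul, mul_sub,
    qTrace_commutes_L hq0 (h.braidCommutes_theta hq0 hWV hVW),
    qTrace_commutes_L hq0 (h.braidCommutes_om hq0)]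

theorem brstOp_T (hl : lam q ≠ 0) : (Matrix.diagonal fun _ => brstOp q ω L V) * T =
    T * (Matrix.diagonal fun _ => brstOp q ω L V) + T * ω := by
  rw [diagonal_brstOp, smul_mul_assoc, mul_smul_comm, sub_mul, mul_sub,
    h.qTrace_theta_T hq0 hWV hVW, h.qTrace_om_T hq0, sub_sub_eq_add_sub, add_sub_right_comm,
    smul_add, smul_smul, inv_mul_cancel₀ hl, one_smul]

theorem brstOp_om (hl : lam q ≠ 0) : (Matrix.diagonal fun _ => brstOp q ω L V) * ω +
    ω * (Matrix.diagonal fun _ => brstOp q ω L V) = -(ω * ω) := by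
  have h1 : ReflectionOdd q ω := h.om_om
  have h2 := h1.anticomm hq0
  rw [diagonal_brstOp, smul_mul_assoc, mul_smul_comm, sub_mul, mul_sub,
    h.qTrace_theta_om hq0 hWV hVW, ← smul_add]
  have e : ∀ x y z : Matrix (Fin N) (Fin N) A, -x - y + (x - z) = -(y + z) := fun x y z => by abel
  rw [e, h2, smul_neg, smul_smul, inv_mul_cancel₀ hl, one_smul]

theorem brstOp_J : (Matrix.diagonal fun _ => brstOp q ω L V) * J +
    J * (Matrix.diagonal fun _ => brstOp q ω L V) = (lam q)⁻¹ • (1 - L) := by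
  rw [diagonal_brstOp, smul_mul_assoc, mul_smul_comm, sub_mul, mul_sub, ← smul_add]
  have e : ∀ x y z w : Matrix (Fin N) (Fin N) A, x - y + (z - w) = (x + z) - (y + w) :=
    fun x y z w => by abel
  rw [e, h.qTrace_theta_J hq0 hWV hVW, h.qTrace_om_J hq0]
  congr 1
  abel

theorem brstOp_T' (hl : lam q ≠ 0) : (Matrix.diagonal fun _ => brstOp q ω L V) * T' =
    T' * (Matrix.diagonal fun _ => brstOp q ω L V) + -(ω * T') := by
  have e := congrArg (fun z => T' * z * T') (h.brstOp_T hq0 hWV hVW hl)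
  simp only [mul_add, add_mul, mul_assoc, mul_tail h.T'_T, h.T_T', mul_one] at e
  rw [e]; abel

end BrstRelations

end BrstOperator

/-! ### Graded commutators and uniqueness of graded derivations -/

section GradedForms

variable {K : Type*} [Field K] {A : Type*} [Ring A] [Algebra K A]

/-- The span of the products `a₀ g₁ a₁ ⋯ gₙ aₙ` with `aₖ ∈ F`, `gₖ ∈ G`. -/
def gradedForms (F : Subalgebra K A) (G : Submodule K A) (n : ℕ) : Submodule K A :=
  Subalgebra.toSubmodule F * (G * Subalgebra.toSubmodule F) ^ n

variable {F : Subalgebra K A} {G : Submodule K A}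

theorem gradedForms_succ (n : ℕ) :
    gradedForms F G (n + 1) = gradedForms F G n * (G * Subalgebra.toSubmodule F) := by
  rw [gradedForms, pow_succ, ← mul_assoc]; rfl

theorem gradedForms_zero : gradedForms F G 0 = Subalgebra.toSubmodule F := by
  simp [gradedForms]

theorem gradedForms_mul_self (n : ℕ) :
    gradedForms F G n * Subalgebra.toSubmodule F = gradedForms F G n := by
  cases n with
  | zero => rw [gradedForms_zero, (Subalgebra.isIdempotentElem_toSubmodule F).eq]
  | succ n => rw [gradedForms_succ, mul_assoc, mul_assoc, (Subalgebra.isIdempotentElem_toSubmodule F).eq]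

theorem gradedForms_mul (m n : ℕ) :
    gradedForms F G m * gradedForms F G n = gradedForms F G (m + n) := by
  nth_rewrite 2 [gradedForms]
  rw [← mul_assoc, gradedForms_mul_self, gradedForms, gradedForms, mul_assoc, ← pow_add]

theorem le_gradedForms_one : G ≤ gradedForms F G 1 := by
  intro g hg
  rw [gradedForms, pow_one, ← one_mul g, ← mul_one g]
  exact Submodule.mul_mem_mul F.one_mem (Submodule.mul_mem_mul hg F.one_mem)

theorem mul_mem_gradedForms {m n : ℕ} {x y : A} (hx : x ∈ gradedForms F G m)
    (hy : y ∈ gradedForms F G n) : x * y ∈ gradedForms F G (m + n) := by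
  rw [← gradedForms_mul]; exact Submodule.mul_mem_mul hx hy

/-- The graded commutator with `Q`, where `σ` is the parity automorphism. -/
def gradedCommutator (σ : A →ₐ[K] A) (Q : A) : A →ₗ[K] A where
  toFun x := Q * x - σ x * Q
  map_add' x y := by rw [mul_add, map_add, add_mul]; abel
  map_smul' c x := by
    rw [mul_smul_comm, map_smul, smul_mul_assoc, ← smul_sub, RingHom.id_apply]

theorem gradedCommutator_apply (σ : A →ₐ[K] A) (Q x : A) :
    gradedCommutator σ Q x = Q * x - σ x * Q := rfl

theorem gradedCommutator_of_odd {σ : A →ₐ[K] A} {x : A} (hx : σ x = -x) (Q : A) :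
    gradedCommutator σ Q x = Q * x + x * Q := by
  rw [gradedCommutator_apply, hx, neg_mul, sub_neg_eq_add]

theorem gradedCommutator_mul (σ : A →ₐ[K] A) (Q x y : A) :
    gradedCommutator σ Q (x * y) =
      gradedCommutator σ Q x * y + σ x * gradedCommutator σ Q y := by
  simp only [gradedCommutator_apply, map_mul, sub_mul, mul_sub, mul_assoc]
  abel

/-- Oddness of `Q` cancels the mixed terms `Qσ(x)Q`, leaving the commutator of `x` with `Q²`. -/
theorem gradedCommutator_sq {σ : A →ₐ[K] A} {Q : A} (hQ : Q * Q = 0) (hσQ : σ Q = -Q) {n : ℕ}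
    {x : A} (hx : σ x = (-1) ^ n * x) :
    gradedCommutator σ Q (gradedCommutator σ Q x) = 0 := by
  have hσσ : σ (σ x) = x := by
    rw [hx, map_mul, map_pow, map_neg, map_one, hx, ← mul_assoc, ← pow_add,
      Even.neg_one_pow ⟨n, rfl⟩, one_mul]
  calc gradedCommutator σ Q (gradedCommutator σ Q x)
      = Q * Q * x - x * (Q * Q) + (Q * σ x * Q - Q * σ x * Q) := by
        simp only [gradedCommutator_apply, map_sub, map_mul, hσQ, hσσ, neg_mul, mul_neg,
          mul_assoc]
        abel
    _ = 0 := by rw [hQ]; simp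

/-- On forms, `σ` is the parity, and the graded commutator with `Q` raises the degree by one. -/
theorem gradedCommutator_mem {σ : A →ₐ[K] A} {Q : A} (hF : ∀ x ∈ F, σ x = x)
    (hG : ∀ x ∈ G, σ x = -x) (hQF : ∀ x ∈ F, gradedCommutator σ Q x ∈ gradedForms F G 1)
    (hQG : ∀ x ∈ G, gradedCommutator σ Q x ∈ gradedForms F G 2) (n : ℕ) {x : A}
    (hx : x ∈ gradedForms F G n) :
    σ x = (-1) ^ n * x ∧ gradedCommutator σ Q x ∈ gradedForms F G (n + 1) := by
  induction n generalizing x with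
  | zero =>
    rw [gradedForms_zero] at hx
    exact ⟨by rw [hF x hx, pow_zero, one_mul], hQF x hx⟩
  | succ n ih =>
    rw [gradedForms_succ] at hx
    refine Submodule.mul_induction_on hx (fun y hy z hz => ?_) fun y z hy hz => ?_
    · refine Submodule.mul_induction_on hz (fun g hg a ha => ?_) fun u v hu hv => ?_
      · obtain ⟨h1, h2⟩ := ih hy
        have ha0 : a ∈ gradedForms F G 0 := by rw [gradedForms_zero]; exact ha
        have hg1 := le_gradedForms_one (F := F) hg
        have hpow : ((-1 : A)) ^ n * y ∈ gradedForms F G n := by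
          rcases neg_one_pow_eq_or A n with e | e <;> rw [e]
          · simpa using hy
          · simpa using hy
        constructor
        · rw [map_mul, map_mul, h1, hG g hg, hF a ha, pow_succ]
          simp only [mul_neg, neg_mul, mul_one, mul_assoc]
        · rw [gradedCommutator_mul, gradedCommutator_mul, mul_add, h1, hG g hg]
          refine Submodule.add_mem _ ?_ (Submodule.add_mem _ ?_ ?_)
          · have := mul_mem_gradedForms h2 (mul_mem_gradedForms hg1 ha0)
            simpa only [Nat.add_zero] using this
          · have := mul_mem_gradedForms hpow (mul_mem_gradedForms (hQG g hg) ha0)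
            simpa only [Nat.add_zero] using this
          · have := mul_mem_gradedForms hpow
              (mul_mem_gradedForms ((gradedForms F G 1).neg_mem hg1) (hQF a ha))
            exact this
      · rw [mul_add]
        exact ⟨by rw [map_add, hu.1, hv.1, mul_add], by
          rw [map_add]; exact Submodule.add_mem _ hu.2 hv.2⟩
    · exact ⟨by rw [map_add, hy.1, hz.1, mul_add], by
        rw [map_add]; exact Submodule.add_mem _ hy.2 hz.2⟩

/-- A graded derivation of a subalgebra vanishing on generators of `F` and on `G` vanishes on all
forms. -/
theorem gradedDerivation_eq_zero {N : ℕ} {Ω : Subalgebra K A} {T T' : Matrix (Fin N) (Fin N) A}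
    (hT'T : T' * T = 1) (hTT' : T * T' = 1)
    (hF : F = Algebra.adjoin K {x | ∃ i j, x = T i j ∨ x = T' i j}) (hFΩ : ∀ x ∈ F, x ∈ Ω)
    (δ : Ω →ₗ[K] Ω)
    (leib : ∀ (n : ℕ) (x y : Ω), (x : A) ∈ gradedForms F G n →
      δ (x * y) = δ x * y + (-1) ^ n * (x * δ y))
    (hT : ∀ (i j : Fin N) (x : Ω), (x : A) = T i j → δ x = 0)
    (hG : ∀ g ∈ G, ∃ hg : g ∈ Ω, δ ⟨g, hg⟩ = 0) (n : ℕ) {x : A} (hx : x ∈ gradedForms F G n) :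
    ∃ h : x ∈ Ω, δ ⟨x, h⟩ = 0 := by
  let Z : Submodule K A :=
    { carrier := {x | ∃ h : x ∈ Ω, δ ⟨x, h⟩ = 0}
      add_mem' := fun {a b} ⟨ha, ha'⟩ ⟨hb, hb'⟩ => ⟨Ω.add_mem ha hb, by
        have := δ.map_add ⟨a, ha⟩ ⟨b, hb⟩
        rw [ha', hb', add_zero] at this
        exact this⟩
      zero_mem' := ⟨Ω.zero_mem, δ.map_zero⟩
      smul_mem' := fun c a ⟨ha, ha'⟩ => ⟨Ω.smul_mem ha c, by
        have := δ.map_smul c ⟨a, ha⟩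
        rw [ha', smul_zero] at this
        exact this⟩ }
  have hmul : ∀ (n : ℕ) (a b : A), a ∈ gradedForms F G n → a ∈ Z → b ∈ Z → a * b ∈ Z := by
    rintro n a b hn ⟨ha, ha'⟩ ⟨hb, hb'⟩
    refine ⟨Ω.mul_mem ha hb, ?_⟩
    have := leib n ⟨a, ha⟩ ⟨b, hb⟩ hn
    rw [ha', hb', zero_mul, mul_zero, mul_zero, add_zero] at this
    exact this
  have hF0 : ∀ x, x ∈ F → x ∈ gradedForms F G 0 := fun x hx => by rw [gradedForms_zero]; exact hx
  have h1 : (1 : A) ∈ Z := by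
    refine ⟨Ω.one_mem, ?_⟩
    have := leib 0 1 1 (hF0 _ F.one_mem)
    rw [pow_zero, one_mul, one_mul, one_mul, mul_one, left_eq_add] at this
    exact this
  have hTF : ∀ i j, T i j ∈ F := fun i j => hF ▸ Algebra.subset_adjoin ⟨i, j, Or.inl rfl⟩
  have hT'F : ∀ i j, T' i j ∈ F := fun i j => hF ▸ Algebra.subset_adjoin ⟨i, j, Or.inr rfl⟩
  have hTZ : ∀ i j, T i j ∈ Z := fun i j => ⟨hFΩ _ (hTF i j), hT i j _ rfl⟩
  -- No value on `T⁻¹` is prescribed: applying `δ` to `TT⁻¹ = 1` gives `T δ(T⁻¹) = 0`, and `T` is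
  -- invertible.
  have hT'Z : ∀ i j, T' i j ∈ Z := by
    let Y : Matrix (Fin N) (Fin N) A := Matrix.of fun i j => (δ ⟨T' i j, hFΩ _ (hT'F i j)⟩ : A)
    have hTY : T * Y = 0 := by
      ext i j
      have e1 : (∑ k, (⟨T i k, hFΩ _ (hTF i k)⟩ : Ω) * ⟨T' k j, hFΩ _ (hT'F k j)⟩) =
          if i = j then 1 else 0 := by
        apply Subtype.ext
        have := congrFun (congrFun hTT' i) j
        rw [Matrix.mul_apply, Matrix.one_apply] at this
        rw [AddSubmonoidClass.coe_finsetSum]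
        split_ifs at this ⊢ <;> exact this
      have e2 := congrArg δ e1
      have e3 : δ (if i = j then 1 else 0) = 0 := by
        split_ifs
        · exact h1.2
        · exact δ.map_zero
      rw [map_sum, e3] at e2
      have e4 := congrArg (Subtype.val) e2
      rw [AddSubmonoidClass.coe_finsetSum] at e4
      rw [Matrix.mul_apply, Matrix.zero_apply]
      refine Eq.trans (Finset.sum_congr rfl fun k _ => ?_) e4
      rw [leib 0 _ _ (hF0 _ (hTF i k)), hT i k _ rfl]
      simp [Y]
    have hY : Y = 0 := by
      calc Y = T' * (T * Y) := by rw [← mul_assoc, hT'T, one_mul]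
        _ = 0 := by rw [hTY, mul_zero]
    exact fun i j => ⟨hFΩ _ (hT'F i j), Subtype.ext (congrFun (congrFun hY i) j)⟩
  have hFZ : ∀ x ∈ F, x ∈ Z := by
    intro x hx
    rw [hF] at hx
    induction hx using Algebra.adjoin_induction with
    | mem x hx =>
      obtain ⟨i, j, rfl | rfl⟩ := hx
      · exact hTZ i j
      · exact hT'Z i j
    | algebraMap r =>
      rw [Algebra.algebraMap_eq_smul_one]
      exact Z.smul_mem r h1
    | add x y hx hy ihx ihy => exact Z.add_mem ihx ihy
    | mul x y hx hy ihx ihy =>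
      exact hmul 0 x y (hF0 x (hF ▸ hx)) ihx ihy
  suffices hs : ∀ n, gradedForms F G n ≤ Z from hs n hx
  intro n
  induction n with
  | zero => rw [gradedForms_zero]; exact hFZ
  | succ n ih =>
    rw [gradedForms_succ]
    refine Submodule.mul_le.mpr fun a ha b hb => hmul n a b ha (ih ha) ?_
    exact Submodule.mul_le.mpr (fun g hg f hf =>
      hmul 1 g f (le_gradedForms_one hg) (hG g hg) (hFZ f hf)) hb

/-- The difference satisfies the same Leibniz rule and vanishes on `T` and `G`, hence on all forms,
and these span `Ω`. -/
theorem gradedDerivation_ext {N : ℕ} {Ω : Subalgebra K A} {T T' : Matrix (Fin N) (Fin N) A}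
    (hT'T : T' * T = 1) (hTT' : T * T' = 1)
    (hF : F = Algebra.adjoin K {x | ∃ i j, x = T i j ∨ x = T' i j}) (hFΩ : ∀ x ∈ F, x ∈ Ω)
    (hGΩ : ∀ g ∈ G, g ∈ Ω) (d d' : Ω →ₗ[K] Ω)
    (leib : ∀ (n : ℕ) (x y : Ω), (x : A) ∈ gradedForms F G n →
      d (x * y) = d x * y + (-1) ^ n * (x * d y))
    (leib' : ∀ (n : ℕ) (x y : Ω), (x : A) ∈ gradedForms F G n →
      d' (x * y) = d' x * y + (-1) ^ n * (x * d' y))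
    (hT : ∀ (i j : Fin N) (x : Ω), (x : A) = T i j → d' x = d x)
    (hG : ∀ g : Ω, (g : A) ∈ G → d' g = d g)
    (hΩ : Subalgebra.toSubmodule Ω ≤ ⨆ n, gradedForms F G n) : d' = d := by
  have key : ∀ n, gradedForms F G n ≤ (LinearMap.ker (d' - d)).map Ω.val.toLinearMap := by
    intro n x hx
    obtain ⟨h, hx'⟩ := gradedDerivation_eq_zero hT'T hTT' hF hFΩ (d' - d)
      (fun n x y hx => by
        rw [LinearMap.sub_apply, LinearMap.sub_apply, LinearMap.sub_apply, leib n x y hx,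
          leib' n x y hx]
        simp only [sub_mul, mul_sub]
        abel)
      (fun i j x hx => by rw [LinearMap.sub_apply, hT i j x hx, sub_self])
      (fun g hg => ⟨hGΩ g hg, by rw [LinearMap.sub_apply, hG _ hg, sub_self]⟩) n hx
    exact ⟨_, hx', rfl⟩
  ext1 x
  obtain ⟨y, hy, hyx⟩ := (iSup_le key) (hΩ x.2)
  have : y = x := Subtype.ext hyx
  subst this
  rw [← sub_eq_zero, ← LinearMap.sub_apply]
  exact hy

theorem BrstRelations.gradedCommutator_brstOp {N : ℕ} {q : K}
    {T T' L ω J V : Matrix (Fin N) (Fin N) A} (h : BrstRelations q T T' L ω J) (hq0 : q ≠ 0)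
    (hl : lam q ≠ 0) (hWV : (1 + lam q • (ω * J)) * V = 1) (hVW : V * (1 + lam q • (ω * J)) = 1)
    {σ : A →ₐ[K] A} (hσT : ∀ i j, σ (T i j) = T i j) (hσT' : ∀ i j, σ (T' i j) = T' i j)
    (hσω : ∀ i j, σ (ω i j) = -ω i j)
    (hF : F = Algebra.adjoin K {x | ∃ i j, x = T i j ∨ x = T' i j}) (n : ℕ) {x : A}
    (hx : x ∈ gradedForms F (entries K ω) n) :
    σ x = (-1) ^ n * x ∧
      gradedCommutator σ (brstOp q ω L V) x ∈ gradedForms F (entries K ω) (n + 1) := by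
  set G := entries K ω with hG
  have hTF : ∀ i j, T i j ∈ F := fun i j => hF ▸ Algebra.subset_adjoin ⟨i, j, Or.inl rfl⟩
  have hT'F : ∀ i j, T' i j ∈ F := fun i j => hF ▸ Algebra.subset_adjoin ⟨i, j, Or.inr rfl⟩
  have hωG : ∀ i j, ω i j ∈ gradedForms F G 1 := fun i j =>
    le_gradedForms_one (entriesIn_entries ω i j)
  have hF0 : ∀ x ∈ F, x ∈ gradedForms F G 0 := fun x hx => by rw [gradedForms_zero]; exact hx
  have c1 : ∀ x ∈ F, σ x = x := by
    intro x hx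
    rw [hF] at hx
    induction hx using Algebra.adjoin_induction with
    | mem x hx =>
      obtain ⟨i, j, rfl | rfl⟩ := hx
      · exact hσT i j
      · exact hσT' i j
    | algebraMap r => exact σ.commutes r
    | add x y _ _ hx hy => rw [map_add, hx, hy]
    | mul x y _ _ hx hy => rw [map_mul, hx, hy]
  have c2 : ∀ x ∈ G, σ x = -x := by
    intro x hx
    induction hx using Submodule.span_induction with
    | mem x hx =>
      obtain ⟨i, j, rfl⟩ := hx
      exact hσω i j
    | zero => rw [map_zero, neg_zero]
    | add x y _ _ hx hy => rw [map_add, hx, hy, neg_add]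
    | smul c x _ hx => rw [map_smul, hx, smul_neg]
  refine gradedCommutator_mem c1 c2 (fun x hx => ?_) (fun x hx => ?_) n hx
  · rw [hF] at hx
    induction hx using Algebra.adjoin_induction with
    | mem x hx =>
      obtain ⟨i, j, rfl | rfl⟩ := hx
      · rw [gradedCommutator_apply, hσT, entry_commutator (h.brstOp_T hq0 hWV hVW hl) i j,
          Matrix.mul_apply]
        exact Submodule.sum_mem _ fun k _ => by
          simpa only [zero_add] using mul_mem_gradedForms (hF0 _ (hTF i k)) (hωG k j)
      · rw [gradedCommutator_apply, hσT', entry_commutator (h.brstOp_T' hq0 hWV hVW hl) i j,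
          Matrix.neg_apply, Matrix.mul_apply]
        exact Submodule.neg_mem _ (Submodule.sum_mem _ fun k _ => by
          simpa only [add_zero] using mul_mem_gradedForms (hωG i k) (hF0 _ (hT'F k j)))
    | algebraMap r =>
      rw [gradedCommutator_apply, AlgHom.commutes, Algebra.commutes, sub_self]
      exact Submodule.zero_mem _
    | add x y _ _ ihx ihy => rw [map_add]; exact Submodule.add_mem _ ihx ihy
    | mul x y hx hy ihx ihy =>
      rw [← hF] at hx hy
      rw [gradedCommutator_mul, c1 x hx]
      exact Submodule.add_mem _
        (by simpa only [add_zero] using mul_mem_gradedForms ihx (hF0 y hy))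
        (by simpa only [zero_add] using mul_mem_gradedForms (hF0 x hx) ihy)
  · induction hx using Submodule.span_induction with
    | mem x hx =>
      obtain ⟨i, j, rfl⟩ := hx
      rw [gradedCommutator_of_odd (hσω i j),
        entry_anticommutator (h.brstOp_om hq0 hWV hVW hl) i j, Matrix.neg_apply, Matrix.mul_apply]
      refine Submodule.neg_mem _ (Submodule.sum_mem _ fun k _ => ?_)
      have := mul_mem_gradedForms (hωG i k) (hωG k j)
      exact this
    | zero => rw [map_zero]; exact Submodule.zero_mem _
    | add x y _ _ hx hy => rw [map_add]; exact Submodule.add_mem _ hx hy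
    | smul c x _ hx => rw [map_smul]; exact Submodule.smul_mem _ c hx

end GradedForms

/-! ### Finite expansions of `V` and `Q` -/

section Statements

variable {K : Type*} [Field K] {A : Type*} [Ring A] [Algebra K A] {N : ℕ}

theorem list_ofFn_prod_mem_pow (G : Submodule K A) (n : ℕ) (x : Fin n → A) (hx : ∀ k, x k ∈ G) :
    (List.ofFn x).prod ∈ G ^ n := by
  induction n with
  | zero => exact Submodule.one_le.mp (pow_zero G).ge
  | succ n ih =>
    rw [List.ofFn_succ, List.prod_cons, pow_succ']
    exact Submodule.mul_mem_mul (hx 0) (ih _ fun k => hx k.succ)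

theorem exists_coeff_of_mem_adjoin {B : Type*} [Ring B] [Algebra K B] {U V : B}
    (hV : V ∈ Algebra.adjoin K {U}) :
    ∃ (n : ℕ) (c : ℕ → K), V = ∑ k ∈ Finset.range n, c k • U ^ k := by
  rw [Algebra.adjoin_singleton_eq_range_aeval] at hV
  obtain ⟨p, rfl⟩ := hV
  exact ⟨_, p.coeff, Polynomial.aeval_eq_sum_range U⟩

theorem BrstRelations.brstOp_mem {q : K} {T T' L ω J V : Matrix (Fin N) (Fin N) A}
    (h : BrstRelations q T T' L ω J) (hq0 : q ≠ 0) (hq : ∀ n : ℕ, 0 < n → q ^ n ≠ 1)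
    (hV : V ∈ Algebra.adjoin K {ω * J}) : brstOp q ω L V ∈
      ⨆ r ∈ Finset.range (N ^ 2), entries K ω ^ (r + 1) * (1 ⊔ entries K L) * entries K J ^ r := by
  refine Submodule.add_mem _ (Submodule.neg_mem _ (Submodule.smul_mem _ _ ?_))
    (Submodule.smul_mem _ _ ?_)
  -- For `N = 0` there is no term `r = 0` to hold `Tr_q ω`, but the trace is then an empty sum.
  · rcases N.eq_zero_or_pos with rfl | hN
    · rw [qTrace_eq, Finset.univ_eq_empty, Finset.sum_empty]
      exact Submodule.zero_mem _
    · have h0 : entries K ω ≤ entries K ω ^ (0 + 1) * (1 ⊔ entries K L) * entries K J ^ 0 := by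
        rw [zero_add, pow_one, pow_zero, mul_one]
        nth_rewrite 1 [← mul_one (entries K ω)]
        exact mul_le_mul_right le_sup_left _
      have hle := h0.trans (le_iSup₂_of_le
        (f := fun r (_ : r ∈ Finset.range (N ^ 2)) =>
          entries K ω ^ (r + 1) * (1 ⊔ entries K L) * entries K J ^ r) 0
        (Finset.mem_range.mpr (by positivity)) le_rfl)
      exact ((entriesIn_entries ω).mono hle).qTrace_mem
  · have hle : (⨆ r ∈ Finset.range (N ^ 2), entries K ω ^ (r + 1) * entries K L * entries K J ^ r) ≤
        ⨆ r ∈ Finset.range (N ^ 2),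
          entries K ω ^ (r + 1) * (1 ⊔ entries K L) * entries K J ^ r :=
      iSup₂_mono fun r _ => mul_le_mul_left (mul_le_mul_right le_sup_right _) _
    exact hle (h.qTrace_theta_mem hq0 hq hV)

end Statements

/-! ### The de Rham algebra and its differential -/

section DeRham

variable {K : Type*} [Field K] (N : ℕ) (q : K)

theorem forms_eq (n : ℕ) :
    forms N q n = gradedForms (funAlg N q) (entrySpan N q (matOm N q)) n := rfl

theorem funAlg_le_deRham {x : DiffAlg N q} (hx : x ∈ funAlg N q) : x ∈ deRham N q := by
  refine Algebra.adjoin_mono ?_ hx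
  rintro _ ⟨i, j, h | h⟩
  · exact ⟨i, j, Or.inl h⟩
  · exact ⟨i, j, Or.inr (Or.inl h)⟩

theorem entrySpan_om_le_deRham :
    entrySpan N q (matOm N q) ≤ Subalgebra.toSubmodule (deRham N q) := by
  refine Submodule.span_le.mpr ?_
  rintro _ ⟨i, j, rfl⟩
  exact Algebra.subset_adjoin ⟨i, j, Or.inr (Or.inr rfl)⟩

theorem forms_le_deRham (n : ℕ) : forms N q n ≤ Subalgebra.toSubmodule (deRham N q) := by
  rw [forms_eq]
  induction n with
  | zero => rw [gradedForms_zero]; exact fun x hx => funAlg_le_deRham N q hx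
  | succ n ih =>
    rw [gradedForms_succ]
    have h1 : entrySpan N q (matOm N q) * Subalgebra.toSubmodule (funAlg N q) ≤
        Subalgebra.toSubmodule (deRham N q) :=
      Submodule.mul_le.mpr fun g hg f hf =>
        (deRham N q).mul_mem (entrySpan_om_le_deRham N q hg) (funAlg_le_deRham N q hf)
    exact Submodule.mul_le.mpr fun a ha b hb => (deRham N q).mul_mem (ih ha) (h1 hb)

/-- The degrees need not be known to be independent: the sum of the form spaces contains the
generators and is closed under products. Identities linear in a form thus extend to the whole
algebra. -/
theorem deRham_le_forms :
    Subalgebra.toSubmodule (deRham N q) ≤ ⨆ n, forms N q n := by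
  have hle : ∀ n, forms N q n ≤ ⨆ n, forms N q n := le_iSup _
  have h0 : ∀ x ∈ funAlg N q, x ∈ ⨆ n, forms N q n := fun x hx => hle 0 (by
    rw [forms_eq, gradedForms_zero]; exact hx)
  intro x hx
  change x ∈ deRham N q at hx
  induction hx using Algebra.adjoin_induction with
  | mem x hx =>
    obtain ⟨i, j, rfl | rfl | rfl⟩ := hx
    · exact h0 _ (Algebra.subset_adjoin ⟨i, j, Or.inl rfl⟩)
    · exact h0 _ (Algebra.subset_adjoin ⟨i, j, Or.inr rfl⟩)
    · exact hle 1 (le_gradedForms_one (Submodule.subset_span ⟨i, j, rfl⟩))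
  | algebraMap r => exact h0 _ ((funAlg N q).algebraMap_mem r)
  | add x y _ _ hx hy => exact Submodule.add_mem _ hx hy
  | mul x y _ _ hx hy =>
    have hm : (⨆ n, forms N q n) * (⨆ n, forms N q n) ≤ ⨆ n, forms N q n := by
      rw [Submodule.iSup_mul]
      refine iSup_le fun m => ?_
      rw [Submodule.mul_iSup]
      refine iSup_le fun n => ?_
      rw [forms_eq, forms_eq, gradedForms_mul, ← forms_eq]
      exact hle _
    exact hm (Submodule.mul_mem_mul hx hy)

variable {q} (hq0 : q ≠ 0) (hq : ∀ n : ℕ, 0 < n → q ^ n ≠ 1)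
include hq0 hq

/-- This excludes the default value of `Ring.inverse` and identifies it with the inverse constructed
in `K[ωJ]`. -/
theorem matWinv_spec : matWinv N q ∈ Algebra.adjoin K {matOm N q * matJ N q} ∧
    (1 + lam q • (matOm N q * matJ N q)) * matWinv N q = 1 ∧
    matWinv N q * (1 + lam q • (matOm N q * matJ N q)) = 1 := by
  obtain ⟨V, hV, h1, h2⟩ := (brstRelations N q).exists_inverse hq0 hq
  have hu : IsUnit (matW N q) := ⟨⟨_, V, h1, h2⟩, rfl⟩
  have h3 : matW N q * matWinv N q = 1 := Ring.mul_inverse_cancel _ hu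
  have h4 : matWinv N q * matW N q = 1 := Ring.inverse_mul_cancel _ hu
  have h5 : matWinv N q = V := left_inv_eq_right_inv h4 h1
  exact ⟨h5 ▸ hV, h3, h4⟩

theorem gradedCommutator_brst_forms (n : ℕ) {x : DiffAlg N q} (hx : x ∈ forms N q n) :
    parity N q x = (-1) ^ n * x ∧
      gradedCommutator (parity N q) (brst N q) x ∈ forms N q (n + 1) := by
  obtain ⟨-, h1, h2⟩ := matWinv_spec N hq0 hq
  exact (brstRelations N q).gradedCommutator_brstOp hq0 (lam_ne_zero hq0 hq) h1 h2 (parity_T N q)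
    (parity_Tinv N q) (parity_om N q) rfl n hx

theorem gradedCommutator_brst_mem {x : DiffAlg N q} (hx : x ∈ deRham N q) :
    gradedCommutator (parity N q) (brst N q) x ∈ deRham N q := by
  have hle : (⨆ n, forms N q n) ≤ (Subalgebra.toSubmodule (deRham N q)).comap
      (gradedCommutator (parity N q) (brst N q)) := iSup_le fun n x hx =>
    forms_le_deRham N q (n + 1) (gradedCommutator_brst_forms N hq0 hq n hx).2
  exact hle (deRham_le_forms N q hx)

/-- The de Rham differential, the graded commutator with `Q`. -/
noncomputable def deRhamD : deRham N q →ₗ[K] deRham N q where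
  toFun x := ⟨gradedCommutator (parity N q) (brst N q) x,
    gradedCommutator_brst_mem N hq0 hq x.2⟩
  map_add' _ _ := Subtype.ext (map_add _ _ _)
  map_smul' c _ := Subtype.ext (map_smul _ c _)

theorem coe_deRhamD (x : deRham N q) : (deRhamD N hq0 hq x : DiffAlg N q) =
    gradedCommutator (parity N q) (brst N q) x := rfl

theorem isDeRhamDifferential_deRhamD : IsDeRhamDifferential N q (deRhamD N hq0 hq) where
  leibniz n x y hx := by
    apply Subtype.ext
    have := gradedCommutator_mul (parity N q) (brst N q) (x : DiffAlg N q) y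
    rw [(gradedCommutator_brst_forms N hq0 hq n hx).1, mul_assoc] at this
    exact this
  map_T i j x hx := by
    obtain ⟨-, h1, h2⟩ := matWinv_spec N hq0 hq
    rw [coe_deRhamD, gradedCommutator_apply, hx, parity_T]
    exact entry_commutator
      ((brstRelations N q).brstOp_T hq0 h1 h2 (lam_ne_zero hq0 hq)) i j
  map_om i j x hx := by
    obtain ⟨-, h1, h2⟩ := matWinv_spec N hq0 hq
    rw [coe_deRhamD, hx, gradedCommutator_of_odd (parity_om N q i j)]
    exact entry_anticommutator
      ((brstRelations N q).brstOp_om hq0 h1 h2 (lam_ne_zero hq0 hq)) i j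

omit hq0 hq in
theorem IsDeRhamDifferential.unique {d d' : deRham N q →ₗ[K] deRham N q}
    (hd : IsDeRhamDifferential N q d) (hd' : IsDeRhamDifferential N q d') : d' = d := by
  refine gradedDerivation_ext (brstRelations N q).T'_T (brstRelations N q).T_T' rfl
    (fun x hx => funAlg_le_deRham N q hx) (fun g hg => entrySpan_om_le_deRham N q hg) d d'
    hd.leibniz hd'.leibniz
    (fun i j x hx => Subtype.ext ((hd'.map_T i j x hx).trans (hd.map_T i j x hx).symm))
    (fun g hg => ?_) (deRham_le_forms N q)
  obtain ⟨g, hg'⟩ := g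
  change g ∈ entrySpan N q (matOm N q) at hg
  induction hg using Submodule.span_induction with
  | mem x hx =>
    obtain ⟨i, j, rfl⟩ := hx
    exact Subtype.ext ((hd'.map_om i j _ rfl).trans (hd.map_om i j _ rfl).symm)
  | zero => exact (map_zero d').trans (map_zero d).symm
  | add x y hx hy ihx ihy =>
    have hx' := entrySpan_om_le_deRham N q hx
    have hy' := entrySpan_om_le_deRham N q hy
    refine (map_add d' ⟨x, hx'⟩ ⟨y, hy'⟩).trans ?_
    rw [ihx hx', ihy hy']
    exact (map_add d ⟨x, hx'⟩ ⟨y, hy'⟩).symm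
  | smul c x hx ih =>
    have hx' := entrySpan_om_le_deRham N q hx
    refine (map_smul d' c ⟨x, hx'⟩).trans ?_
    rw [ih hx']
    exact (map_smul d c ⟨x, hx'⟩).symm

theorem deRhamD_comp_self [CharZero K] : deRhamD N hq0 hq ∘ₗ deRhamD N hq0 hq = 0 := by
  obtain ⟨-, h1, h2⟩ := matWinv_spec N hq0 hq
  have hb := brstRelations N q
  have hQ : brst N q * brst N q = 0 := hb.brstOp_mul_self hq0 h1 h2 hq
  have hσ : parity N q (brst N q) = -brst N q :=
    brstOp_neg (parity N q) (by ext i j; exact parity_om N q i j) (map_parity_L N q)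
      (by ext i j; exact parity_J N q i j) h1 h2
  have key : ∀ n, forms N q n ≤ LinearMap.ker
      ((gradedCommutator (parity N q) (brst N q)) ∘ₗ
        (gradedCommutator (parity N q) (brst N q))) := by
    intro n x hx
    exact gradedCommutator_sq hQ hσ (gradedCommutator_brst_forms N hq0 hq n hx).1
  ext1 x
  exact Subtype.ext ((iSup_le key) (deRham_le_forms N q x.2))

end DeRham

end GLq

/-! ### The main theorem -/

theorem mainTheorem3 {K : Type*} [Field K] [CharZero K] (N : ℕ) (q : K) (hq0 : q ≠ 0)
    (hq : ∀ n : ℕ, 0 < n → q ^ n ≠ 1) :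
    -- monomials of order `N² + 1` in the entries of `ω` vanish
    (∀ a b : Fin (N ^ 2 + 1) → Fin N,
      (List.ofFn fun k => GLq.matOm N q (a k) (b k)).prod = 0) ∧
    -- `1 + λ ω J` is invertible, and its inverse is a finite series in `ω J`
    IsUnit (GLq.matW N q) ∧
    (∃ (n : ℕ) (c : ℕ → K), GLq.matWinv N q =
      ∑ k ∈ Finset.range n, c k • (GLq.matOm N q * GLq.matJ N q) ^ k) ∧
    -- `Q` is a finite sum of ordered monomials with at most `N²` factors `ω`
    GLq.brst N q ∈ (⨆ r ∈ Finset.range (N ^ 2),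
      GLq.entrySpan N q (GLq.matOm N q) ^ (r + 1) *
        (1 ⊔ GLq.entrySpan N q (GLq.matL N q)) *
        GLq.entrySpan N q (GLq.matJ N q) ^ r : Submodule K (GLq.DiffAlg N q)) ∧
    -- the geometric expansion of `Q` to every order `m`; `m = 0` is the second closed form
    (∀ m : ℕ, GLq.brst N q = GLq.qTrace q
      ((GLq.lam q)⁻¹ • (GLq.matOm N q * (GLq.matL N q - 1)) -
        ∑ k ∈ Finset.range m, (-GLq.lam q) ^ k •
          (GLq.matOm N q * GLq.matL N q * (GLq.matOm N q * GLq.matJ N q) ^ (k + 1)) -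
        (-GLq.lam q) ^ m • (GLq.matOm N q * GLq.matL N q *
          (GLq.matOm N q * GLq.matJ N q) ^ (m + 1) * GLq.matWinv N q))) ∧
    -- `Q² = 0`, `[Q, L] = 0`
    GLq.brst N q * GLq.brst N q = 0 ∧
    (∀ i j, GLq.brst N q * GLq.matL N q i j - GLq.matL N q i j * GLq.brst N q = 0) ∧
    -- `[Q, T] = T ω`
    (∀ i j, GLq.brst N q * GLq.matT N q i j - GLq.matT N q i j * GLq.brst N q =
      (GLq.matT N q * GLq.matOm N q) i j) ∧
    -- `[Q, ω]₊ = -ω²`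
    (∀ i j, GLq.brst N q * GLq.matOm N q i j + GLq.matOm N q i j * GLq.brst N q =
      -(GLq.matOm N q * GLq.matOm N q) i j) ∧
    -- `[Q, J]₊ = λ⁻¹ (1 - L)`
    (∀ i j, GLq.brst N q * GLq.matJ N q i j + GLq.matJ N q i j * GLq.brst N q =
      ((GLq.lam q)⁻¹ • (1 - GLq.matL N q)) i j) ∧
    -- the graded commutator with `Q` is the de Rham differential on the de Rham algebra
    (∃ d : GLq.deRham N q →ₗ[K] GLq.deRham N q,
      GLq.IsDeRhamDifferential N q d ∧
      (∀ d' : GLq.deRham N q →ₗ[K] GLq.deRham N q,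
        GLq.IsDeRhamDifferential N q d' → d' = d) ∧
      d ∘ₗ d = 0 ∧
      (∀ (n : ℕ) (x : GLq.deRham N q), (x : GLq.DiffAlg N q) ∈ GLq.forms N q n →
        (d x : GLq.DiffAlg N q) ∈ GLq.forms N q (n + 1) ∧
        (d x : GLq.DiffAlg N q) =
          GLq.brst N q * (x : GLq.DiffAlg N q) -
            (-1) ^ n * ((x : GLq.DiffAlg N q) * GLq.brst N q))) := by
  obtain ⟨hV, h1, h2⟩ := GLq.matWinv_spec N hq0 hq
  have hb := GLq.brstRelations N q
  have hl := GLq.lam_ne_zero hq0 hq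
  refine ⟨fun a b => ?_, ⟨⟨_, _, h1, h2⟩, rfl⟩, GLq.exists_coeff_of_mem_adjoin hV,
    hb.brstOp_mem hq0 hq hV, GLq.brstOp_expansion hl h1, hb.brstOp_mul_self hq0 h1 h2 hq,
    fun i j => ?_, GLq.entry_commutator (hb.brstOp_T hq0 h1 h2 hl),
    GLq.entry_anticommutator (hb.brstOp_om hq0 h1 h2 hl),
    GLq.entry_anticommutator (hb.brstOp_J hq0 h1 h2),
    GLq.deRhamD N hq0 hq, GLq.isDeRhamDifferential_deRhamD N hq0 hq,
    fun d' hd' => (GLq.isDeRhamDifferential_deRhamD N hq0 hq).unique N hd',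
    GLq.deRhamD_comp_self N hq0 hq, fun n x hx => ⟨?_, ?_⟩⟩
  · have := GLq.list_ofFn_prod_mem_pow (GLq.entries K (GLq.matOm N q)) _
      (fun k => GLq.matOm N q (a k) (b k)) fun k => GLq.entriesIn_entries _ _ _
    rw [hb.pow_entries_om hq0 hq] at this
    exact (Submodule.mem_bot K).mp this
  · exact GLq.entry_commutator ((hb.brstOp_L hq0 h1 h2).trans (add_zero _).symm) i j
  · exact (GLq.gradedCommutator_brst_forms N hq0 hq n hx).2
  · rw [GLq.coe_deRhamD, GLq.gradedCommutator_apply,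
      (GLq.gradedCommutator_brst_forms N hq0 hq n hx).1, mul_assoc]
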